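/- Let $\mathcal X\subset\mathbb R^d$ be nonempty, compact and convex, $D=\max_{x,y\in\mathcal X}\|x-y\|_\infty$, let $\mu>0$, and put $\mathcal X_\mu=\{x:\operatorname{dist}(x,\mathcal X)\le\mu\}$. Let $\xi$ be a random element with law $P$, let $f(x;\xi)$ be jointly measurable with $\sup_{x\in\mathcal X_\mu}\mathbb E|f(x;\xi)|<\infty$, and let $f(x)=\mathbb E_\xi[f(x;\xi)]$. Assume that $f$ is convex and $L_c$-Lipschitz on $\mathcal X_\mu$ and $L$-smooth (differentiable with $L$-Lipschitz gradient) on the open set $\{x:\operatorname{dist}(x,\mathcal X)<\mu\}$, and let $x_\star\in\arg\min_{x\in\mathcal X}f(x)$. Let $(\xi_t,u_t)_{t\ge1}$ be i.i.d. pairs, where $\xi_t\sim P$ and $u_t$, uniform on the unit sphere of $\mathbb R^d$, are independent. Let $\alpha>0$, $0\le\beta_1<1$, $0<\beta_2<1$, $\gamma=\beta_1^2/\beta_2<1$, $\epsilon>0$, $x_1\in\mathcal X$. ZO-AdaMM starts from $m_0=v_0=0$, $\hat v_0=\epsilon\mathbf 1$, and for $t=1,2,\dots$ sets (all operations on vectors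 being coordinatewise) $$\hat g_t=\tfrac d\mu\,[f(x_t+\mu u_t;\xi_t)-f(x_t;\xi_t)]\,u_t,\qquad m_t=\beta_1m_{t-1}+(1-\beta_1)\hat g_t,\qquad v_t=\beta_2v_{t-1}+(1-\beta_2)\hat g_t^2,$$ $$\hat v_t=\max(\hat v_{t-1},v_t),\qquad x_{t+1}=\arg\min_{y\in\mathcal X}\ \sum_{i=1}^d\hat v_{t,i}^{1/2}\Big(y_i-x_{t,i}+\tfrac{\alpha}{\sqrt t}\,\hat v_{t,i}^{-1/2}m_{t,i}\Big)^2 .$$ Let $f_{t,\mu}(x)=\mathbb E_{w}[f(x+\mu w;\xi_t)]$, where $w$ is uniform on the unit ball and independent of everything else, the expectation being over $w$ only. Then for every $T\ge1$ the random variables $\sum_{t=1}^T\big(f_{t,\mu}(x_t)-f_{t,\mu}(x_\star)\big)$ and $\hat v_{T,i}^{1/2}$ are integrable and $$\mathbb E\Big[\sum_{t=1}^T f_{t,\mu}(x_t)-f_{t,\mu}(x_\star)\Big]\le\frac{D^2\sqrt T}{2\alpha(1-\beta_1)}\sum_{i=1}^d\mathbb E\big[\hat v_{T,i}^{1/2}\big]+\frac{\alpha\sqrt{1+\log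 T}}{\sqrt{(1-\beta_2)(1-\gamma)}}\sum_{i=1}^d\sqrt{\sum_{t=1}^T\mathbb E\big[\hat g_{t,i}^2\big]},$$ where the expectations of the nonnegative variables $\hat g_{t,i}^2$ take values in $[0,\infty]$. -/

import Mathlib

open MeasureTheory ProbabilityTheory
open scoped NNReal ENNReal

namespace ZOAdaMM

/-- Euclidean space `ℝ^d`. -/
abbrev E (d : ℕ) : Type := EuclideanSpace ℝ (Fin d)

/-- The uniform probability measure on the unit sphere of `ℝ^d` (normalized surface measure),
viewed as a measure on `ℝ^d`. -/
noncomputable def unifSphere (d : ℕ) : Measure (E d) :=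
  (cond (volume : Measure (E d)).toSphere Set.univ).map Subtype.val

/-- The uniform probability measure on the closed unit ball of `ℝ^d`. -/
noncomputable def unifBall (d : ℕ) : Measure (E d) :=
  cond (volume : Measure (E d)) (Metric.closedBall 0 1)

/-- `‖x‖_v^2 = ⟨x, diag(v) x⟩`. -/
noncomputable def weightedSqNorm {d : ℕ} (v x : E d) : ℝ := ∑ i, v i * x i ^ 2

/-- The weighted projection `argmin_{z ∈ X} ‖z - y‖_v^2`; the minimizer exists and is unique when
`X` is nonempty, compact and convex and all `v i` are positive. -/
noncomputable def weightedProj {d : ℕ} (X : Set (E d)) (v y : E d) : E d :=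
  Classical.epsilon fun z => z ∈ X ∧ IsMinOn (fun w => weightedSqNorm v (w - y)) X z

/-- The diameter `max_{x, y ∈ X} ‖x - y‖_∞` (the target `Fin d → ℝ` carries the sup norm). -/
noncomputable def supDiam {d : ℕ} (X : Set (E d)) : ℝ :=
  Metric.diam ((fun x : E d => (WithLp.ofLp x : Fin d → ℝ)) '' X)

/-- `L`-smoothness on an open set: differentiable with `L`-Lipschitz gradient. -/
def LSmoothOn {d : ℕ} (L : ℝ≥0) (F : E d → ℝ) (U : Set (E d)) : Prop :=
  DifferentiableOn ℝ F U ∧ LipschitzOnWith L (gradient F) U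

variable {d : ℕ} {Ξ : Type*}

/-- The two-point gradient estimator `(d/μ) [f(x + μ u; s) - f(x; s)] u`. -/
noncomputable def zoGrad (f : E d → Ξ → ℝ) (μ : ℝ) (x : E d) (s : Ξ) (u : E d) : E d :=
  ((d : ℝ) / μ * (f (x + μ • u) s - f x s)) • u

/-- The smoothed loss `𝔼_{u ∼ U_B} f(x + μ u; s)`, `u` uniform on the unit ball. -/
noncomputable def smoothed (f : E d → Ξ → ℝ) (μ : ℝ) (s : Ξ) (x : E d) : ℝ :=
  ∫ u, f (x + μ • u) s ∂(unifBall d)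

/-- Parameters of the method. -/
structure Params where
  α : ℝ
  β₁ : ℝ
  β₂ : ℝ
  ε : ℝ
  μ : ℝ

/-- Memory of the method after `t` steps: `x = x_{t+1}`, `m = m_t`, `v = v_t`, `vhat = v̂_t`. -/
structure State (d : ℕ) where
  x : E d
  m : E d
  v : E d
  vhat : E d

/-- Step `t ≥ 1` of AMSGrad with gradient input `g`, step size `α / √t`. -/
noncomputable def amsgradStep (p : Params) (X : Set (E d)) (t : ℕ) (g : E d) (S : State d) :
    State d :=
  let m : E d := p.β₁ • S.m + (1 - p.β₁) • g
  let v : E d := WithLp.toLp 2 fun i => p.β₂ * S.v i + (1 - p.β₂) * g i ^ 2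
  let vhat : E d := WithLp.toLp 2 fun i => max (S.vhat i) (v i)
  let y : E d := WithLp.toLp 2 fun i => S.x i - p.α / √(t : ℝ) * (m i / √(vhat i))
  { x := weightedProj X (WithLp.toLp 2 fun i => √(vhat i)) y
    m := m
    v := v
    vhat := vhat }

/-- ZO-AdaMM along a sequence of samples `ξ 1, ξ 2, …` and directions `u 1, u 2, …`, started at
`x₁` with `m_0 = v_0 = 0` and `v̂_0 = ε 𝟏`. -/
noncomputable def run (p : Params) (X : Set (E d)) (f : E d → Ξ → ℝ) (x₁ : E d)
    (ξ : ℕ → Ξ) (u : ℕ → E d) : ℕ → State d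
  | 0 => { x := x₁, m := 0, v := 0, vhat := WithLp.toLp 2 fun _ => p.ε }
  | t + 1 =>
    let S := run p X f x₁ ξ u t
    amsgradStep p X (t + 1) (zoGrad f p.μ S.x (ξ (t + 1)) (u (t + 1))) S

/-- The iterate `x_t`, for `t ≥ 1`. -/
noncomputable def iter (p : Params) (X : Set (E d)) (f : E d → Ξ → ℝ) (x₁ : E d)
    (ξ : ℕ → Ξ) (u : ℕ → E d) (t : ℕ) : E d :=
  (run p X f x₁ ξ u (t - 1)).x

/-- The gradient estimate `ĝ_t` used at step `t ≥ 1`. -/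
noncomputable def gradEst (p : Params) (X : Set (E d)) (f : E d → Ξ → ℝ) (x₁ : E d)
    (ξ : ℕ → Ξ) (u : ℕ → E d) (t : ℕ) : E d :=
  zoGrad f p.μ (iter p X f x₁ ξ u t) (ξ t) (u t)

/-- The second-moment vector `v̂_t`. -/
noncomputable def vHat (p : Params) (X : Set (E d)) (f : E d → Ξ → ℝ) (x₁ : E d)
    (ξ : ℕ → Ξ) (u : ℕ → E d) (t : ℕ) : E d :=
  (run p X f x₁ ξ u t).vhat

/-- The smoothed regret `∑_{t=1}^T (f_{t,μ}(x_t) - f_{t,μ}(z))` with `f_t = f(·; ξ_t)`. -/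
noncomputable def smoothedRegret (p : Params) (X : Set (E d)) (f : E d → Ξ → ℝ) (x₁ : E d)
    (ξ : ℕ → Ξ) (u : ℕ → E d) (T : ℕ) (z : E d) : ℝ :=
  ∑ t ∈ Finset.Icc 1 T,
    (smoothed f p.μ (ξ t) (iter p X f x₁ ξ u t) - smoothed f p.μ (ξ t) z)

end ZOAdaMM

open ZOAdaMM

/-!
Write `H w = F (x + μ w) - F x`. Convexity bounds `F (x + μ w) - F (z + μ w)` by the derivative of
`H` at `w` along `(x - z) / μ`, which exists almost everywhere by Rademacher's theorem. Averaging
over the ball and applying the divergence theorem turns this derivative into the mean over the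
sphere of the two-point estimator paired with `x - z`. Since `x_t` depends only on the samples
before time `t`, it may be frozen when averaging over the sample of step `t`, so the expected
smoothed regret is at most `𝔼 ∑ ⟨ĝ_t, x_t - z⟩`.

This sum is bounded along every trajectory. Abel summation replaces `ĝ_t` by the momentum `m_t` at
the cost of the drift terms `⟨m_t, x_t - x_{t+1}⟩` and a boundary term; the projection in the metric
`v̂_t^{1/2}` makes `∑ ⟨m_t, x_t - z⟩` telescope, up to the monotone growth of `√t v̂_t^{1/2}`, which
the diameter absorbs. What is left is `∑ (α / √t) m_t² / v̂_t^{1/2}`, and the Cauchy–Schwarz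
estimate `(1 - β₂) (1 - β₁² / β₂) m_t² ≤ (1 - β₁)² v_t` makes it linear in the moving average of
`|ĝ_t|`. Cauchy–Schwarz against the harmonic sum and Jensen's inequality for the square root
conclude.
-/

namespace ZOAdaMM

section Divergence

open Metric Set Filter Topology

theorem hasDerivAt_max_sub_zero {a ρ : ℝ} (h : a ≠ ρ) :
    HasDerivAt (fun r => max (r - a) 0) ((Iio ρ).indicator 1 a) ρ := by
  rcases lt_or_gt_of_ne h with h | h
  · rw [indicator_of_mem (mem_Iio.2 h)]
    refine ((hasDerivAt_id ρ).sub_const a).congr_of_eventuallyEq ?_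
    filter_upwards [lt_mem_nhds h] with r hr using max_eq_left (sub_nonneg.2 hr.le)
  · rw [indicator_of_notMem (notMem_Iio.2 h.le)]
    refine (hasDerivAt_const ρ (0 : ℝ)).congr_of_eventuallyEq ?_
    filter_upwards [gt_mem_nhds h] with r hr using max_eq_right (sub_nonpos.2 hr.le)

variable {V : Type*} [NormedAddCommGroup V]

theorem lipschitzWith_max_sub_norm (ρ : ℝ) :
    LipschitzWith 1 (fun w : V => max (ρ - ‖w‖) 0) := by
  have h : LipschitzWith (0 + 1) (fun w : V => ρ - ‖w‖) :=
    (LipschitzWith.const ρ).sub lipschitzWith_one_norm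
  rw [zero_add] at h
  exact h.max_const 0

theorem hasCompactSupport_max_sub_norm [ProperSpace V] (ρ : ℝ) :
    HasCompactSupport (fun w : V => max (ρ - ‖w‖) 0) := by
  refine HasCompactSupport.intro (isCompact_closedBall (0 : V) ρ) fun w hw => ?_
  exact max_eq_right (sub_nonpos.2 (by simpa using hw : ρ < ‖w‖).le)

theorem integrable_mul_max_sub_norm [ProperSpace V] [MeasurableSpace V] [BorelSpace V]
    {ν : Measure V} [IsFiniteMeasureOnCompacts ν] {h : V → ℝ} (hm : AEStronglyMeasurable h ν)
    {C : ℝ} (hC : ∀ w, ‖h w‖ ≤ C) (ρ : ℝ) :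
    Integrable (fun w => h w * max (ρ - ‖w‖) 0) ν :=
  ((lipschitzWith_max_sub_norm ρ).continuous.integrable_of_hasCompactSupport
    (hasCompactSupport_max_sub_norm ρ)).bdd_mul hm (Eventually.of_forall hC)

theorem hasDerivAt_integral_mul_max_sub_norm [NormedSpace ℝ V] [FiniteDimensional ℝ V]
    [Nontrivial V] [MeasurableSpace V] [BorelSpace V] {ν : Measure V} [ν.IsAddHaarMeasure]
    {h : V → ℝ} (hm : AEStronglyMeasurable h ν) {C : ℝ} (hC : ∀ w, ‖h w‖ ≤ C) (ρ : ℝ) :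
    HasDerivAt (fun r => ∫ w, h w * max (r - ‖w‖) 0 ∂ν) (∫ w in ball (0 : V) ρ, h w ∂ν) ρ := by
  have hC0 : 0 ≤ C := (norm_nonneg _).trans (hC 0)
  have : ProperSpace V := FiniteDimensional.proper ℝ V
  have hlip (w : V) : LipschitzOnWith
      (Real.nnabs ((ball (0 : V) (ρ + 1)).indicator (fun _ => C) w))
      (fun r => h w * max (r - ‖w‖) 0) (ball ρ 1) := by
    refine LipschitzOnWith.of_dist_le_mul fun r hr s hs => ?_
    rw [dist_eq_norm_sub, ← mul_sub, norm_mul, Real.dist_eq]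
    by_cases hw : w ∈ ball (0 : V) (ρ + 1)
    · rw [indicator_of_mem hw, Real.coe_nnabs, abs_of_nonneg hC0]
      gcongr
      · exact hC w
      · simpa using abs_max_sub_max_le_abs (r - ‖w‖) (s - ‖w‖) 0
    · have hle : ∀ q ∈ ball ρ 1, q - ‖w‖ ≤ 0 := fun q hq => by
        have hq' := (abs_lt.1 (mem_ball_iff_norm.1 hq)).2
        have hw' : ρ + 1 ≤ ‖w‖ := by simpa using hw
        linarith
      rw [max_eq_right (hle r hr), max_eq_right (hle s hs)]
      simp [hw]
  have hderiv : ∀ᵐ w ∂ν, HasDerivAt (fun r => h w * max (r - ‖w‖) 0)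
      ((ball (0 : V) ρ).indicator h w) ρ := by
    filter_upwards [measure_eq_zero_iff_ae_notMem.1 (Measure.addHaar_sphere ν 0 ρ)] with w hw
    have hd := (hasDerivAt_max_sub_zero (show ‖w‖ ≠ ρ by simpa using hw)).const_mul (h w)
    by_cases hlt : ‖w‖ < ρ <;> simpa [indicator, hlt] using hd
  rw [← integral_indicator measurableSet_ball]
  refine (hasDerivAt_integral_of_dominated_loc_of_lip (ball_mem_nhds ρ one_pos)
    (Eventually.of_forall fun r => (integrable_mul_max_sub_norm hm hC r).aestronglyMeasurable)
    (integrable_mul_max_sub_norm hm hC ρ) (hm.indicator measurableSet_ball)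
    (Eventually.of_forall hlip) ?_ hderiv).2
  exact (integrable_indicator_iff measurableSet_ball).2 (integrableOn_const measure_ball_lt_top.ne)

variable [InnerProductSpace ℝ V]

theorem lineDeriv_max_sub_norm {ρ : ℝ} {w : V} (hw : w ≠ 0) (hρ : ‖w‖ ≠ ρ) (v : V) :
    lineDeriv ℝ (fun w : V => max (ρ - ‖w‖) 0) w (-v) =
      (ball (0 : V) ρ).indicator (fun w => inner ℝ w v / ‖w‖) w := by
  rcases lt_or_gt_of_ne hρ with h | h
  · have hev : (fun w : V => max (ρ - ‖w‖) 0) =ᶠ[𝓝 w] fun w => ρ - √(‖w‖ ^ 2) := by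
      filter_upwards [(continuous_norm.tendsto w).eventually (gt_mem_nhds h)] with y hy
      rw [Real.sqrt_sq (norm_nonneg y)]
      exact max_eq_left (sub_nonneg.2 hy.le)
    have hd := (((hasStrictFDerivAt_norm_sq w).hasFDerivAt.sqrt (by simpa using hw)).const_sub
      ρ).hasLineDerivAt (-v)
    rw [hev.lineDeriv_eq, indicator_of_mem (by simpa using h), hd.lineDeriv]
    have : ‖w‖ ≠ 0 := by simpa using hw
    simp only [Real.sqrt_sq (norm_nonneg w), one_div, mul_inv_rev, neg_apply, smul_apply,
      coe_innerSL_apply, inner_neg_right, smul_neg, nsmul_eq_mul, Nat.cast_ofNat, smul_eq_mul,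
      mul_neg, neg_neg]
    field_simp
  · have hev : (fun w : V => max (ρ - ‖w‖) 0) =ᶠ[𝓝 w] fun _ => 0 := by
      filter_upwards [(continuous_norm.tendsto w).eventually (lt_mem_nhds h)] with y hy
      exact max_eq_right (sub_nonpos.2 hy.le)
    rw [hev.lineDeriv_eq, indicator_of_notMem (by simpa using h.le)]
    simp [lineDeriv]

variable [FiniteDimensional ℝ V] [MeasurableSpace V] [BorelSpace V] (ν : Measure V)
  [ν.IsAddHaarMeasure]

theorem integrableOn_ball_inner_div_norm_mul {G : V → ℝ} (hG : Continuous G) (v : V) (ρ : ℝ) :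
    IntegrableOn (fun w => inner ℝ w v / ‖w‖ * G w) (ball 0 ρ) ν := by
  have hGint : IntegrableOn G (ball 0 ρ) ν :=
    (hG.continuousOn.integrableOn_compact (isCompact_closedBall 0 ρ)).mono_set
      ball_subset_closedBall
  refine hGint.bdd_mul (c := ‖v‖)
    ((measurable_id.inner_const).div measurable_norm).aestronglyMeasurable
    (Eventually.of_forall fun w => ?_)
  rw [norm_div, norm_norm]
  exact div_le_of_le_mul₀ (norm_nonneg _) (norm_nonneg _)
    ((norm_inner_le_norm w v).trans_eq (mul_comm _ _))

variable [Nontrivial V]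

theorem integral_eq_integral_Ioi_mul_integral_toSphere {h : V → ℝ} (hh : Integrable h ν) :
    ∫ w, h w ∂ν = ∫ r in Ioi (0 : ℝ), r ^ (Module.finrank ℝ V - 1) *
      ∫ θ : sphere (0 : V) 1, h (r • (θ : V)) ∂ν.toSphere := by
  have hmp := ν.measurePreserving_homeomorphUnitSphereProd
  have hemb : MeasurableEmbedding (homeomorphUnitSphereProd V) :=
    Homeomorph.measurableEmbedding _
  let q : sphere (0 : V) 1 × Ioi (0 : ℝ) → ℝ := fun x => h ((x.2 : ℝ) • (x.1 : V))
  have hcomp : q ∘ homeomorphUnitSphereProd V = h ∘ Subtype.val := by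
    funext ⟨x, hx⟩
    have hx0 : ‖x‖ ≠ 0 := by simpa using hx
    simp [q, smul_smul, hx0]
  have hint : Integrable q (ν.toSphere.prod (.volumeIoiPow (Module.finrank ℝ V - 1))) := by
    rw [← hmp.integrable_comp_emb hemb, hcomp,
      ← integrableOn_iff_comap_subtypeVal (measurableSet_singleton _).compl]
    exact hh.integrableOn
  calc ∫ w, h w ∂ν = ∫ x : ({(0 : V)}ᶜ : Set V), h x ∂(ν.comap (↑)) := by
        rw [integral_subtype_comap (measurableSet_singleton _).compl h, restrict_compl_singleton]
    _ = ∫ x, q x ∂ν.toSphere.prod (.volumeIoiPow (Module.finrank ℝ V - 1)) := by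
        rw [← hmp.integral_comp hemb]
        exact integral_congr_ae (Eventually.of_forall fun x => (congrFun hcomp x).symm)
    _ = ∫ r : Ioi (0 : ℝ), (∫ θ : sphere (0 : V) 1, h ((r : ℝ) • (θ : V)) ∂ν.toSphere)
          ∂(.volumeIoiPow (Module.finrank ℝ V - 1)) := integral_prod_symm _ hint
    _ = _ := by
        simp only [Measure.volumeIoiPow, ENNReal.ofReal]
        rw [integral_withDensity_eq_integral_smul
            (measurable_subtype_coe.pow_const _).real_toNNReal,
          integral_subtype_comap measurableSet_Ioi
            fun a : ℝ ↦ Real.toNNReal (a ^ (Module.finrank ℝ V - 1)) •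
              ∫ θ : sphere (0 : V) 1, h (a • (θ : V)) ∂ν.toSphere]
        refine setIntegral_congr_fun measurableSet_Ioi fun r hr => ?_
        simp only [NNReal.smul_def, Real.coe_toNNReal _ (pow_nonneg (le_of_lt hr) _), smul_eq_mul]

theorem integral_lineDeriv_mul_max_sub_norm {K : ℝ≥0} {G : V → ℝ} (hG : LipschitzWith K G) (v : V)
    {ρ : ℝ} (hρ : 0 < ρ) :
    ∫ w, lineDeriv ℝ G w v * max (ρ - ‖w‖) 0 ∂ν =
      ∫ r in (0 : ℝ)..ρ, r ^ (Module.finrank ℝ V - 1) *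
        ∫ θ : sphere (0 : V) 1, inner ℝ (θ : V) v * G (r • (θ : V)) ∂ν.toSphere := by
  set h : V → ℝ := (ball (0 : V) ρ).indicator (fun w => inner ℝ w v / ‖w‖ * G w) with hh
  have hint : Integrable h ν := (integrable_indicator_iff measurableSet_ball).2
    (integrableOn_ball_inner_div_norm_mul ν hG.continuous v ρ)
  have hae : (fun w => lineDeriv ℝ (fun w : V => max (ρ - ‖w‖) 0) w (-v) * G w) =ᵐ[ν] h := by
    filter_upwards [Measure.ae_ne ν 0,
      measure_eq_zero_iff_ae_notMem.1 (Measure.addHaar_sphere ν 0 ρ)] with w hw0 hw1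
    rw [lineDeriv_max_sub_norm hw0 (by simpa using hw1), hh]
    by_cases hw : w ∈ ball (0 : V) ρ <;> simp [hw]
  have hpolar {r : ℝ} (hr : 0 < r) (θ : sphere (0 : V) 1) :
      h (r • (θ : V)) = (Iio ρ).indicator (fun r => inner ℝ (θ : V) v * G (r • (θ : V))) r := by
    have hnorm : ‖r • (θ : V)‖ = r := by simp [norm_smul, abs_of_pos hr]
    by_cases hrρ : r < ρ
    · rw [hh, indicator_of_mem (by simpa [hnorm] using hrρ), indicator_of_mem (mem_Iio.2 hrρ),
        hnorm, real_inner_smul_left, mul_div_cancel_left₀ _ hr.ne']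
    · rw [hh, indicator_of_notMem (by simpa [hnorm] using hrρ),
        indicator_of_notMem (mt mem_Iio.1 hrρ)]
  rw [hG.integral_lineDeriv_mul_eq (lipschitzWith_max_sub_norm ρ)
    (hasCompactSupport_max_sub_norm ρ) v, integral_congr_ae hae,
    integral_eq_integral_Ioi_mul_integral_toSphere ν hint, intervalIntegral.integral_of_le hρ.le,
    integral_Ioc_eq_integral_Ioo, ← Ioi_inter_Iio, ← setIntegral_indicator measurableSet_Iio]
  refine setIntegral_congr_fun measurableSet_Ioi fun r (hr : 0 < r) => ?_
  by_cases hrρ : r < ρ <;> simp [hpolar hr, hrρ]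

-- Both sides are the derivatives in `ρ` of the two sides of the tent-function identity above.
theorem setIntegral_ball_lineDeriv_eq_mul_integral_toSphere {K : ℝ≥0} {G : V → ℝ}
    (hG : LipschitzWith K G) (v : V) {ρ : ℝ} (hρ : 0 < ρ) :
    ∫ w in ball (0 : V) ρ, lineDeriv ℝ G w v ∂ν =
      ρ ^ (Module.finrank ℝ V - 1) *
        ∫ θ : sphere (0 : V) 1, inner ℝ (θ : V) v * G (ρ • (θ : V)) ∂ν.toSphere := by
  set A : ℝ → ℝ := fun r => r ^ (Module.finrank ℝ V - 1) *
    ∫ θ : sphere (0 : V) 1, inner ℝ (θ : V) v * G (r • (θ : V)) ∂ν.toSphere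
  have hA : Continuous A := by
    have hGc := hG.continuous
    have hc : Continuous (Function.uncurry fun (r : ℝ) (θ : sphere (0 : V) 1) =>
        inner ℝ (θ : V) v * G (r • (θ : V))) := by
      unfold Function.uncurry
      fun_prop
    refine (continuous_pow _).mul ?_
    simpa using continuous_parametric_integral_of_continuous (μ := ν.toSphere) hc isCompact_univ
  have hleft := hasDerivAt_integral_mul_max_sub_norm (ν := ν)
    (measurable_lineDeriv (v := v) hG.continuous).aestronglyMeasurable
    (fun w => norm_lineDeriv_le_of_lipschitz ℝ hG) ρ
  have hright : HasDerivAt (fun r => ∫ w, lineDeriv ℝ G w v * max (r - ‖w‖) 0 ∂ν) (A ρ) ρ := by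
    refine (intervalIntegral.integral_hasDerivAt_right (hA.intervalIntegrable 0 ρ)
      (hA.stronglyMeasurableAtFilter _ _) hA.continuousAt).congr_of_eventuallyEq ?_
    filter_upwards [lt_mem_nhds hρ] with r hr
    exact integral_lineDeriv_mul_max_sub_norm ν hG v hr
  exact hleft.unique hright

end Divergence

section Smoothing

open Metric Set Filter Topology

variable {d : ℕ}

instance isProbabilityMeasure_unifBall : IsProbabilityMeasure (unifBall d) :=
  cond_isProbabilityMeasure_of_finite (measure_closedBall_pos _ _ one_pos).ne'
    measure_closedBall_lt_top.ne

instance isProbabilityMeasure_unifSphere [NeZero d] : IsProbabilityMeasure (unifSphere d) := by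
  have : IsProbabilityMeasure (cond (volume : Measure (E d)).toSphere univ) :=
    cond_isProbabilityMeasure_of_finite
      (mt Measure.measure_univ_eq_zero.1 (Measure.toSphere_ne_zero _)) (measure_ne_top _ _)
  exact Measure.isProbabilityMeasure_map measurable_subtype_coe.aemeasurable

theorem ae_norm_le_one_unifBall : ∀ᵐ w ∂unifBall d, ‖w‖ ≤ 1 := by
  filter_upwards [ae_cond_mem (μ := (volume : Measure (E d))) measurableSet_closedBall] with w hw
  simpa using hw

theorem ae_norm_eq_one_unifSphere : ∀ᵐ u ∂unifSphere d, ‖u‖ = 1 := by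
  rw [unifSphere, (MeasurableEmbedding.subtype_coe isClosed_sphere.measurableSet).ae_map_iff]
  exact Eventually.of_forall fun u => norm_eq_of_mem_sphere u

theorem integral_unifBall [NeZero d] (h : E d → ℝ) :
    ∫ w, h w ∂unifBall d =
      (volume.real (ball (0 : E d) 1))⁻¹ * ∫ w in ball (0 : E d) 1, h w := by
  have hae : closedBall (0 : E d) 1 =ᵐ[volume] ball (0 : E d) 1 :=
    (ae_eq_of_subset_of_measure_ge ball_subset_closedBall
      (Measure.addHaar_closedBall_eq_addHaar_ball volume 0 1).le
      measurableSet_ball.nullMeasurableSet measure_closedBall_lt_top.ne).symm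
  rw [unifBall, ProbabilityTheory.cond, integral_smul_measure, Measure.restrict_congr_set hae,
    measure_congr hae, ENNReal.toReal_inv, smul_eq_mul, Measure.real]

theorem integral_unifSphere (h : E d → ℝ) :
    ∫ u, h u ∂unifSphere d = ((d : ℝ) * volume.real (ball (0 : E d) 1))⁻¹ *
      ∫ θ : sphere (0 : E d) 1, h θ ∂(volume : Measure (E d)).toSphere := by
  rw [unifSphere, (MeasurableEmbedding.subtype_coe isClosed_sphere.measurableSet).integral_map,
    ProbabilityTheory.cond, Measure.restrict_univ, integral_smul_measure, ENNReal.toReal_inv,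
    smul_eq_mul, ← Measure.real, Measure.toSphere_real_apply_univ, finrank_euclideanSpace_fin]

theorem integral_lineDeriv_unifBall [NeZero d] {K : ℝ≥0} {G : E d → ℝ} (hG : LipschitzWith K G)
    (v : E d) :
    ∫ w, lineDeriv ℝ G w v ∂unifBall d = d * ∫ u, inner ℝ u v * G u ∂unifSphere d := by
  have hd : (d : ℝ) ≠ 0 := NeZero.ne _
  rw [integral_unifBall, setIntegral_ball_lineDeriv_eq_mul_integral_toSphere volume hG v one_pos,
    integral_unifSphere]
  simp only [one_pow, one_mul, one_smul]
  field_simp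

theorem sub_le_of_convexOn_of_hasLineDerivAt {V : Type*} [AddCommGroup V] [Module ℝ V] {S : Set V}
    {F : V → ℝ} {F' : ℝ} (hF : ConvexOn ℝ S F) {x y : V} (hx : x ∈ S) (hy : y ∈ S)
    (h : HasLineDerivAt ℝ F F' x (x - y)) : F x - F y ≤ F' := by
  have hconv := hF.comp_affineMap (AffineMap.lineMap x (x + (x - y)))
  have hline (t : ℝ) : AffineMap.lineMap x (x + (x - y)) t = x + t • (x - y) := by
    rw [AffineMap.lineMap_apply_module', add_sub_cancel_left, add_comm]
  have hderiv : HasDerivAt (F ∘ AffineMap.lineMap (k := ℝ) x (x + (x - y))) F' 0 := by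
    simpa only [HasLineDerivAt, Function.comp_def, hline] using h
  have := hconv.slope_le_of_hasDerivAt (x := -1) (y := 0) (by simp [hline, hy])
    (by simp [hx]) (by norm_num) hderiv
  simpa [slope_def_field, hline] using this

theorem add_smul_mem_closedBall {V : Type*} [SeminormedAddCommGroup V] [NormedSpace ℝ V] {μ : ℝ}
    (hμ : 0 ≤ μ) {w : V} (hw : ‖w‖ ≤ 1) (x : V) : x + μ • w ∈ closedBall x μ := by
  rw [mem_closedBall_iff_norm, add_sub_cancel_left, norm_smul, Real.norm_of_nonneg hμ]
  exact mul_le_of_le_one_right hμ hw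

theorem integrable_comp_add_smul_unifBall {F : E d → ℝ} {μ : ℝ} (hμ : 0 ≤ μ) {x : E d}
    (hF : ContinuousOn F (closedBall x μ)) : Integrable (fun w => F (x + μ • w)) (unifBall d) := by
  have hc : ContinuousOn (fun w => F (x + μ • w)) (closedBall 0 1) :=
    hF.comp (by fun_prop) fun w hw => add_smul_mem_closedBall hμ (by simpa using hw) x
  exact (hc.integrableOn_compact (isCompact_closedBall _ _)).smul_measure
    (ENNReal.inv_ne_top.2 (measure_closedBall_pos volume _ one_pos).ne')

-- Integrate the subgradient inequality along `x - z` over the ball, then apply the divergence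
-- theorem to `w ↦ F (x + μ • w) - F x`.
theorem integral_unifBall_sub_le_of_lipschitzWith [NeZero d] {μ : ℝ} (hμ : 0 < μ) {S : Set (E d)}
    {F : E d → ℝ} (hconv : ConvexOn ℝ S F) {K : ℝ≥0} (hlip : LipschitzWith K F) {x z : E d}
    (hx : closedBall x μ ⊆ S) (hz : closedBall z μ ⊆ S) :
    ∫ w, F (x + μ • w) ∂unifBall d - ∫ w, F (z + μ • w) ∂unifBall d ≤
      ∫ u, d / μ * (F (x + μ • u) - F x) * inner ℝ u (x - z) ∂unifSphere d := by
  set H : E d → ℝ := fun w => F (x + μ • w) - F x with hH_def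
  set v : E d := μ⁻¹ • (x - z) with hv
  obtain ⟨K', hH⟩ : ∃ K', LipschitzWith K' H :=
    ⟨_, (hlip.comp ((LipschitzWith.const x).add (lipschitzWith_smul μ))).sub
      (LipschitzWith.const _)⟩
  have hsub : ∀ᵐ w ∂unifBall d, F (x + μ • w) - F (z + μ • w) ≤ lineDeriv ℝ H w v := by
    filter_upwards [ae_norm_le_one_unifBall,
      cond_absolutelyContinuous.ae_le (hH.ae_lineDifferentiableAt (μ := volume) v)] with w hw hdiff
    refine sub_le_of_convexOn_of_hasLineDerivAt hconv (hx (add_smul_mem_closedBall hμ.le hw x))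
      (hz (add_smul_mem_closedBall hμ.le hw z)) ?_
    have hline (t : ℝ) : F (x + μ • w + t • (x + μ • w - (z + μ • w))) = H (w + t • v) + F x := by
      rw [hH_def, hv, sub_add_cancel, add_sub_add_right_eq_sub, smul_add, smul_comm μ t,
        smul_inv_smul₀ hμ.ne', add_assoc]
    simpa only [HasLineDerivAt, hline] using hdiff.hasLineDerivAt.add_const (F x)
  have hint (y : E d) : Integrable (fun w => F (y + μ • w)) (unifBall d) :=
    integrable_comp_add_smul_unifBall hμ.le hlip.continuous.continuousOn
  have hderiv_int : Integrable (fun w => lineDeriv ℝ H w v) (unifBall d) :=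
    Integrable.of_bound (measurable_lineDeriv hH.continuous).aestronglyMeasurable _
      (Eventually.of_forall fun _ => norm_lineDeriv_le_of_lipschitz ℝ hH)
  calc ∫ w, F (x + μ • w) ∂unifBall d - ∫ w, F (z + μ • w) ∂unifBall d
      = ∫ w, (F (x + μ • w) - F (z + μ • w)) ∂unifBall d := (integral_sub (hint x) (hint z)).symm
    _ ≤ ∫ w, lineDeriv ℝ H w v ∂unifBall d :=
        integral_mono_ae ((hint x).sub (hint z)) hderiv_int hsub
    _ = ∫ u, d * (inner ℝ u v * H u) ∂unifSphere d := by
        rw [integral_lineDeriv_unifBall hH, integral_const_mul]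
    _ = ∫ u, d / μ * (F (x + μ • u) - F x) * inner ℝ u (x - z) ∂unifSphere d := by
        refine integral_congr_ae (Eventually.of_forall fun u => ?_)
        simp only [hH_def, hv, real_inner_smul_right]
        ring

theorem integral_unifBall_sub_le [NeZero d] {μ : ℝ} (hμ : 0 < μ) {S : Set (E d)} {F : E d → ℝ}
    (hconv : ConvexOn ℝ S F) {K : ℝ≥0} (hlip : LipschitzOnWith K F S) {x z : E d}
    (hx : closedBall x μ ⊆ S) (hz : closedBall z μ ⊆ S) :
    ∫ w, F (x + μ • w) ∂unifBall d - ∫ w, F (z + μ • w) ∂unifBall d ≤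
      ∫ u, d / μ * (F (x + μ • u) - F x) * inner ℝ u (x - z) ∂unifSphere d := by
  obtain ⟨G, hG, hFG⟩ := hlip.extend_real
  have hball {y : E d} (hy : closedBall y μ ⊆ S) :
      ∫ w, F (y + μ • w) ∂unifBall d = ∫ w, G (y + μ • w) ∂unifBall d := by
    refine integral_congr_ae ?_
    filter_upwards [ae_norm_le_one_unifBall] with w hw
    exact hFG (hy (add_smul_mem_closedBall hμ.le hw y))
  have hsphere : ∫ u, d / μ * (F (x + μ • u) - F x) * inner ℝ u (x - z) ∂unifSphere d =
      ∫ u, d / μ * (G (x + μ • u) - G x) * inner ℝ u (x - z) ∂unifSphere d := by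
    refine integral_congr_ae ?_
    filter_upwards [ae_norm_eq_one_unifSphere] with u hu
    rw [hFG (hx (add_smul_mem_closedBall hμ.le hu.le x)),
      hFG (hx (mem_closedBall_self hμ.le))]
  rw [hball hx, hball hz, hsphere]
  exact integral_unifBall_sub_le_of_lipschitzWith hμ (hconv.congr hFG) hG hx hz

end Smoothing

section WeightedProjection

open Filter Topology

theorem continuousAt_of_isMinOn_unique {Q Y : Type*} [TopologicalSpace Q] [TopologicalSpace Y]
    {h : Q → Y → ℝ} (hh : Continuous (Function.uncurry h)) {K : Set Y} (hK : IsCompact K)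
    {z : Q → Y} (hz : ∀ q, z q ∈ K) (hmin : ∀ q, IsMinOn (h q) K (z q)) {q : Q}
    (huniq : ∀ y ∈ K, IsMinOn (h q) K y → y = z q) : ContinuousAt z q := by
  refine tendsto_iff_ultrafilter _ _ _ |>.2 fun g hg => ?_
  obtain ⟨y, hyK, hy⟩ := hK.ultrafilter_le_nhds (g.map z)
    (le_principal_iff.2 (mem_map.2 (univ_mem' hz)))
  have hlim {w : Q → Y} {a : Y} (hw : Tendsto w g (𝓝 a)) :
      Tendsto (fun p => h p (w p)) g (𝓝 (h q a)) :=
    (hh.tendsto (q, a)).comp (Tendsto.prodMk_nhds hg hw)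
  have hy_min : IsMinOn (h q) K y := fun w hw =>
    le_of_tendsto_of_tendsto' (hlim hy) (hlim tendsto_const_nhds) fun p => hmin p hw
  rwa [← huniq y hyK hy_min]

variable {d : ℕ} {X : Set (E d)}

theorem continuous_weightedSqNorm_sub :
    Continuous fun q : (E d × E d) × E d => weightedSqNorm q.1.1 (q.2 - q.1.2) := by
  unfold weightedSqNorm
  fun_prop

theorem weightedProj_mem_and_isMinOn (hX : IsCompact X) (hne : X.Nonempty) (v y : E d) :
    weightedProj X v y ∈ X ∧
      IsMinOn (fun w => weightedSqNorm v (w - y)) X (weightedProj X v y) := by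
  obtain ⟨z, hz, hmin⟩ := hX.exists_isMinOn hne
    (continuous_weightedSqNorm_sub.comp (Continuous.prodMk_right (v, y))).continuousOn
  exact Classical.epsilon_spec
    (p := fun z => z ∈ X ∧ IsMinOn (fun w => weightedSqNorm v (w - y)) X z) ⟨z, hz, hmin⟩

theorem weightedProj_mem (hX : IsCompact X) (hne : X.Nonempty) (v y : E d) :
    weightedProj X v y ∈ X :=
  (weightedProj_mem_and_isMinOn hX hne v y).1

theorem sum_mul_sub_nonneg_of_isMinOn_weightedSqNorm (hX : Convex ℝ X) {v y z w : E d} (hz : z ∈ X)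
    (hmin : IsMinOn (fun w => weightedSqNorm v (w - y)) X z) (hw : w ∈ X) :
    0 ≤ ∑ i, v i * (z i - y i) * (w i - z i) := by
  have hderiv : HasFDerivAt (fun w => weightedSqNorm v (w - y))
      (∑ i, v i • ((2 * (z i - y i)) • EuclideanSpace.proj (𝕜 := ℝ) i)) z := by
    unfold weightedSqNorm
    refine HasFDerivAt.fun_sum fun i _ => ?_
    have hproj := ((EuclideanSpace.proj (𝕜 := ℝ) i).hasFDerivAt (x := z)).sub_const (y i)
    simpa using (hproj.pow 2).const_mul (v i)
  have hnonneg := hmin.localize.hasFDerivWithinAt_nonneg hderiv.hasFDerivWithinAt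
    (sub_mem_posTangentConeAt_of_segment_subset (hX.segment_subset hz hw))
  have heq : (∑ i, v i • ((2 * (z i - y i)) • EuclideanSpace.proj (𝕜 := ℝ) i)) (w - z) =
      2 * ∑ i, v i * (z i - y i) * (w i - z i) := by
    simp only [sum_apply, smul_apply, Finset.mul_sum, PiLp.proj_apply, PiLp.sub_apply, smul_eq_mul]
    exact Finset.sum_congr rfl fun i _ => by ring
  linarith

theorem eq_of_isMinOn_weightedSqNorm (hX : Convex ℝ X) {v y z z' : E d} (hv : ∀ i, 0 < v i)
    (hz : z ∈ X) (hmin : IsMinOn (fun w => weightedSqNorm v (w - y)) X z)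
    (hz' : z' ∈ X) (hmin' : IsMinOn (fun w => weightedSqNorm v (w - y)) X z') : z = z' := by
  have hsum : ∑ i, v i * (z i - z' i) ^ 2 ≤ 0 := by
    have h := add_nonneg (sum_mul_sub_nonneg_of_isMinOn_weightedSqNorm hX hz hmin hz')
      (sum_mul_sub_nonneg_of_isMinOn_weightedSqNorm hX hz' hmin' hz)
    rw [← neg_nonneg, ← Finset.sum_neg_distrib]
    rw [← Finset.sum_add_distrib] at h
    exact h.trans_eq (Finset.sum_congr rfl fun i _ => by ring)
  have hterm (i : Fin d) : 0 ≤ v i * (z i - z' i) ^ 2 := mul_nonneg (hv i).le (sq_nonneg _)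
  ext i
  have hi := (Finset.sum_eq_zero_iff_of_nonneg fun i _ => hterm i).1
    (hsum.antisymm (Finset.sum_nonneg fun i _ => hterm i)) i (Finset.mem_univ i)
  exact sub_eq_zero.1 (sq_eq_zero_iff.1 ((mul_eq_zero.1 hi).resolve_left (hv i).ne'))

theorem continuousOn_weightedProj (hX : IsCompact X) (hXc : Convex ℝ X) (hne : X.Nonempty) :
    ContinuousOn (fun q : E d × E d => weightedProj X q.1 q.2) {q | ∀ i, 0 < q.1 i} := by
  have hproj (q : E d × E d) := weightedProj_mem_and_isMinOn hX hne q.1 q.2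
  exact fun q hq => (continuousAt_of_isMinOn_unique continuous_weightedSqNorm_sub hX
    (fun q => (hproj q).1) (fun q => (hproj q).2) fun y hy hmin =>
      eq_of_isMinOn_weightedSqNorm hXc hq hy hmin (hproj q).1 (hproj q).2).continuousWithinAt

theorem measurable_weightedProj (hX : IsCompact X) (hXc : Convex ℝ X) (hne : X.Nonempty)
    {Ω : Type*} [MeasurableSpace Ω] {v y : Ω → E d} (hv : Measurable v) (hy : Measurable y)
    (hpos : ∀ ω i, 0 < v ω i) : Measurable fun ω => weightedProj X (v ω) (y ω) := by
  have hcont := continuousOn_iff_continuous_domRestrict.1 (continuousOn_weightedProj hX hXc hne)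
  have hpair : Measurable fun ω => (⟨(v ω, y ω), hpos ω⟩ : {q : E d × E d | ∀ i, 0 < q.1 i}) :=
    (hv.prodMk hy).subtype_mk
  simpa only [Function.comp_def, Set.domRestrict_apply] using hcont.measurable.comp hpair

section ProximalStep

variable (hX : IsCompact X) (hXc : Convex ℝ X) (s x y : E d) {w : E d} (hw : w ∈ X)
include hX hXc hw

theorem sum_mul_weightedProj_sub_le :
    ∑ i, s i * (x i - y i) * (weightedProj X s y i - w i) ≤
      (weightedSqNorm s (x - w) - weightedSqNorm s (weightedProj X s y - w) -
        weightedSqNorm s (weightedProj X s y - x)) / 2 := by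
  obtain ⟨hmem, hmin⟩ := weightedProj_mem_and_isMinOn hX ⟨w, hw⟩ s y
  rw [← sub_nonneg]
  refine (sum_mul_sub_nonneg_of_isMinOn_weightedSqNorm hXc hmem hmin hw).trans_eq ?_
  simp only [weightedSqNorm, ← Finset.sum_sub_distrib, Finset.sum_div, PiLp.sub_apply]
  exact Finset.sum_congr rfl fun i _ => by ring

variable {s} (hs : ∀ i, 0 ≤ s i)
include hs

theorem sum_mul_sub_le_of_weightedProj :
    ∑ i, s i * (x i - y i) * (x i - w i) ≤
      (weightedSqNorm s (x - w) - weightedSqNorm s (weightedProj X s y - w)) / 2 +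
        weightedSqNorm s (x - y) / 2 := by
  set x' := weightedProj X s y
  have hstep : ∑ i, s i * (x i - y i) * (x i - x' i) ≤
      weightedSqNorm s (x' - x) / 2 + weightedSqNorm s (x - y) / 2 := by
    simp only [weightedSqNorm, Finset.sum_div, ← Finset.sum_add_distrib, PiLp.sub_apply]
    refine Finset.sum_le_sum fun i _ => ?_
    linarith [mul_nonneg (hs i) (sq_nonneg ((x i - y i) - (x i - x' i)))]
  have hsplit : ∑ i, s i * (x i - y i) * (x i - w i) =
      ∑ i, s i * (x i - y i) * (x i - x' i) + ∑ i, s i * (x i - y i) * (x' i - w i) := by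
    rw [← Finset.sum_add_distrib]
    exact Finset.sum_congr rfl fun i _ => by ring
  linarith [sum_mul_weightedProj_sub_le hX hXc s x y hw]

end ProximalStep

theorem sum_mul_sub_weightedProj_le (hX : IsCompact X) (hXc : Convex ℝ X) {s x : E d}
    (hs : ∀ i, 0 ≤ s i) (hx : x ∈ X) (y : E d) :
    ∑ i, s i * (x i - y i) * (x i - weightedProj X s y i) ≤ weightedSqNorm s (x - y) := by
  have hlower := sum_mul_weightedProj_sub_le hX hXc s x y hx
  have hupper := sum_mul_sub_le_of_weightedProj hX hXc x y
    (weightedProj_mem hX ⟨x, hx⟩ s y) hs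
  have hneg : ∑ i, s i * (x i - y i) * (x i - weightedProj X s y i) =
      -∑ i, s i * (x i - y i) * (weightedProj X s y i - x i) := by
    rw [← Finset.sum_neg_distrib]
    exact Finset.sum_congr rfl fun i _ => by ring
  have hsymm : weightedSqNorm s (x - weightedProj X s y) =
      weightedSqNorm s (weightedProj X s y - x) := by
    simp only [weightedSqNorm, PiLp.sub_apply, sub_sq_comm]
  have hself : weightedSqNorm s (0 : E d) = 0 := by simp [weightedSqNorm]
  rw [sub_self, hself] at hlower hupper
  linarith

end WeightedProjection

section ExponentialMovingAverage

open Finset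

/-- The exponential moving average `e 0 = 0`, `e (t + 1) = β * e t + (1 - β) * g (t + 1)` of a
sequence indexed from `1`; the moments `m_t` and `v_t` of AMSGrad are of this form. -/
noncomputable def ema (β : ℝ) (g : ℕ → ℝ) : ℕ → ℝ
  | 0 => 0
  | t + 1 => β * ema β g t + (1 - β) * g (t + 1)

variable {β : ℝ} {g : ℕ → ℝ}

theorem ema_nonneg (hβ0 : 0 ≤ β) (hβ1 : β ≤ 1) (hg : ∀ t, 0 ≤ g t) : ∀ t, 0 ≤ ema β g t
  | 0 => le_rfl
  | t + 1 => add_nonneg (mul_nonneg hβ0 (ema_nonneg hβ0 hβ1 hg t))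
      (mul_nonneg (sub_nonneg.2 hβ1) (hg (t + 1)))

theorem abs_ema_le (hβ0 : 0 ≤ β) (hβ1 : β ≤ 1) (t : ℕ) :
    |ema β g t| ≤ ema β (fun s => |g s|) t := by
  induction t with
  | zero => simp [ema]
  | succ t ih =>
    calc |β * ema β g t + (1 - β) * g (t + 1)|
        ≤ β * |ema β g t| + (1 - β) * |g (t + 1)| := by
          refine (abs_add_le _ _).trans_eq ?_
          rw [abs_mul, abs_mul, abs_of_nonneg hβ0, abs_of_nonneg (sub_nonneg.2 hβ1)]
      _ ≤ β * ema β (fun s => |g s|) t + (1 - β) * |g (t + 1)| := by gcongr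

theorem one_sub_sq_div_mul_sq_add_le {b : ℝ} (hb : 0 < b) (a x y : ℝ) :
    (1 - a ^ 2 / b) * (a * x + y) ^ 2 ≤ b * ((1 - a ^ 2 / b) * x ^ 2) + y ^ 2 := by
  have hsq : 0 ≤ ((1 - a ^ 2 / b) * b * x - a * y) ^ 2 / b := by positivity
  rw [← sub_nonneg]
  refine hsq.trans_eq ?_
  field_simp
  ring

theorem ema_sq_le {β₁ β₂ : ℝ} (hβ₂0 : 0 < β₂) (hβ₂1 : β₂ ≤ 1) (t : ℕ) :
    (1 - β₂) * (1 - β₁ ^ 2 / β₂) * ema β₁ g t ^ 2 ≤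
      (1 - β₁) ^ 2 * ema β₂ (fun s => g s ^ 2) t := by
  induction t with
  | zero => simp [ema]
  | succ t ih =>
    have hstep := one_sub_sq_div_mul_sq_add_le hβ₂0 β₁ (ema β₁ g t) ((1 - β₁) * g (t + 1))
    calc (1 - β₂) * (1 - β₁ ^ 2 / β₂) * (β₁ * ema β₁ g t + (1 - β₁) * g (t + 1)) ^ 2
        = (1 - β₂) *
          ((1 - β₁ ^ 2 / β₂) * (β₁ * ema β₁ g t + (1 - β₁) * g (t + 1)) ^ 2) := mul_assoc _ _ _
      _ ≤ (1 - β₂) * (β₂ * ((1 - β₁ ^ 2 / β₂) * ema β₁ g t ^ 2) + ((1 - β₁) * g (t + 1)) ^ 2) :=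
          mul_le_mul_of_nonneg_left hstep (sub_nonneg.2 hβ₂1)
      _ = β₂ * ((1 - β₂) * (1 - β₁ ^ 2 / β₂) * ema β₁ g t ^ 2) +
          (1 - β₁) ^ 2 * ((1 - β₂) * g (t + 1) ^ 2) := by ring
      _ ≤ β₂ * ((1 - β₁) ^ 2 * ema β₂ (fun s => g s ^ 2) t) +
          (1 - β₁) ^ 2 * ((1 - β₂) * g (t + 1) ^ 2) := by gcongr
      _ = (1 - β₁) ^ 2 * ema β₂ (fun s => g s ^ 2) (t + 1) := by simp only [ema]; ring

theorem one_sub_mul_sum_mul_ema_add_le (hβ0 : 0 ≤ β) (hβ1 : β ≤ 1) (hg : ∀ t, 0 ≤ g t) {w : ℕ → ℝ}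
    (hw : Antitone w) (T : ℕ) :
    (1 - β) * ∑ t ∈ range T, w t * ema β g (t + 1) + β * (w T * ema β g T) ≤
      (1 - β) * ∑ t ∈ range T, w t * g (t + 1) := by
  induction T with
  | zero => simp [ema]
  | succ T ih =>
    have hanti : w (T + 1) * ema β g (T + 1) ≤ w T * ema β g (T + 1) :=
      mul_le_mul_of_nonneg_right (hw T.le_succ) (ema_nonneg hβ0 hβ1 hg (T + 1))
    have hrec : w T * ema β g (T + 1) = β * (w T * ema β g T) + (1 - β) * (w T * g (T + 1)) := by
      rw [ema]; ring
    rw [sum_range_succ, sum_range_succ]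
    linarith [mul_le_mul_of_nonneg_left hanti hβ0]

theorem sum_mul_ema_le (hβ0 : 0 ≤ β) (hβ1 : β < 1) (hg : ∀ t, 0 ≤ g t) {w : ℕ → ℝ}
    (hw : Antitone w) (hw0 : ∀ t, 0 ≤ w t) (T : ℕ) :
    ∑ t ∈ range T, w t * ema β g (t + 1) ≤ ∑ t ∈ range T, w t * g (t + 1) := by
  have hlast : 0 ≤ β * (w T * ema β g T) :=
    mul_nonneg hβ0 (mul_nonneg (hw0 T) (ema_nonneg hβ0 hβ1.le hg T))
  refine le_of_mul_le_mul_left ?_ (sub_pos.2 hβ1)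
  linarith [one_sub_mul_sum_mul_ema_add_le hβ0 hβ1.le hg hw T]

theorem one_sub_mul_sum_mul_eq_sum_ema_mul (y : ℕ → ℝ) (T : ℕ) :
    (1 - β) * ∑ t ∈ range T, g (t + 1) * y t =
      (1 - β) * ∑ t ∈ range T, ema β g (t + 1) * y t +
        β * (ema β g T * y T + ∑ t ∈ range T, ema β g (t + 1) * (y t - y (t + 1))) := by
  induction T with
  | zero => simp [ema]
  | succ T ih =>
    simp only [sum_range_succ, mul_add, ih]
    simp only [ema]
    ring

end ExponentialMovingAverage

section WeightedSums

open Finset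

theorem sum_mul_sub_succ_le {c δ : ℕ → ℝ} {B : ℝ} (hc : Monotone c) (hc0 : 0 ≤ c 0)
    (hδ : ∀ t, δ t ≤ B) (T : ℕ) :
    ∑ t ∈ range T, c (t + 1) * (δ t - δ (t + 1)) ≤ c T * (B - δ T) := by
  induction T with
  | zero => simpa using mul_nonneg hc0 (sub_nonneg.2 (hδ 0))
  | succ T ih =>
    rw [sum_range_succ]
    linarith [mul_le_mul_of_nonneg_right (hc T.le_succ) (sub_nonneg.2 (hδ T))]

theorem sum_inv_sqrt_mul_abs_le (g : ℕ → ℝ) (T : ℕ) :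
    ∑ t ∈ range T, (√((t + 1 : ℕ) : ℝ))⁻¹ * |g (t + 1)| ≤
      √(1 + Real.log T) * √(∑ t ∈ range T, g (t + 1) ^ 2) := by
  have hharmonic : ∑ t ∈ range T, ((√((t + 1 : ℕ) : ℝ))⁻¹) ^ 2 ≤ 1 + Real.log T := by
    refine le_of_eq_of_le ?_ (harmonic_le_one_add_log T)
    rw [harmonic, Rat.cast_sum]
    refine sum_congr rfl fun t _ => ?_
    rw [inv_pow, Real.sq_sqrt (Nat.cast_nonneg _), Rat.cast_inv, Rat.cast_natCast]
  calc ∑ t ∈ range T, (√((t + 1 : ℕ) : ℝ))⁻¹ * |g (t + 1)|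
      ≤ √(∑ t ∈ range T, ((√((t + 1 : ℕ) : ℝ))⁻¹) ^ 2) * √(∑ t ∈ range T, |g (t + 1)| ^ 2) :=
        Real.sum_mul_le_sqrt_mul_sqrt _ _ _
    _ ≤ √(1 + Real.log T) * √(∑ t ∈ range T, g (t + 1) ^ 2) := by
        simp only [sq_abs]
        gcongr

variable {β₁ β₂ : ℝ} {g vhat : ℕ → ℝ}

theorem ema_sq_div_sqrt_le (hβ₁0 : 0 ≤ β₁) (hβ₁1 : β₁ < 1) (hβ₂0 : 0 < β₂) (hβ₂1 : β₂ < 1)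
    (hγ : β₁ ^ 2 / β₂ < 1) {t : ℕ} (hv : ema β₂ (fun s => g s ^ 2) t ≤ vhat t) :
    ema β₁ g t ^ 2 / √(vhat t) ≤
      (1 - β₁) / √((1 - β₂) * (1 - β₁ ^ 2 / β₂)) * ema β₁ (fun s => |g s|) t := by
  set κ := (1 - β₂) * (1 - β₁ ^ 2 / β₂)
  have hκ : 0 < κ := mul_pos (sub_pos.2 hβ₂1) (sub_pos.2 hγ)
  have hβ₁ : 0 ≤ 1 - β₁ := sub_nonneg.2 hβ₁1.le
  have habs : |ema β₁ g t| ≤ (1 - β₁) / √κ * √(vhat t) := by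
    rw [div_mul_eq_mul_div, le_div_iff₀ (Real.sqrt_pos.2 hκ), mul_comm]
    calc √κ * |ema β₁ g t| = √(κ * ema β₁ g t ^ 2) := by
          rw [Real.sqrt_mul hκ.le, Real.sqrt_sq_eq_abs]
      _ ≤ √((1 - β₁) ^ 2 * vhat t) :=
          Real.sqrt_le_sqrt ((ema_sq_le hβ₂0 hβ₂1.le t).trans (by gcongr))
      _ = (1 - β₁) * √(vhat t) := by rw [Real.sqrt_mul (sq_nonneg _), Real.sqrt_sq hβ₁]
  have hbound := abs_ema_le (g := g) hβ₁0 hβ₁1.le t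
  have hnonneg : 0 ≤ (1 - β₁) / √κ := by positivity
  refine div_le_of_le_mul₀ (Real.sqrt_nonneg _)
    (mul_nonneg hnonneg ((abs_nonneg _).trans hbound)) ?_
  calc ema β₁ g t ^ 2 = |ema β₁ g t| * |ema β₁ g t| := by rw [← sq, sq_abs]
    _ ≤ ((1 - β₁) / √κ * √(vhat t)) * ema β₁ (fun s => |g s|) t := by gcongr
    _ = (1 - β₁) / √κ * ema β₁ (fun s => |g s|) t * √(vhat t) := by ring

theorem sum_ema_sq_div_sqrt_le {α : ℝ} (hα : 0 ≤ α) (hβ₁0 : 0 ≤ β₁) (hβ₁1 : β₁ < 1)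
    (hβ₂0 : 0 < β₂) (hβ₂1 : β₂ < 1) (hγ : β₁ ^ 2 / β₂ < 1)
    (hv : ∀ t, ema β₂ (fun s => g s ^ 2) t ≤ vhat t) (T : ℕ) :
    ∑ t ∈ range T, α / √((t + 1 : ℕ) : ℝ) * (ema β₁ g (t + 1) ^ 2 / √(vhat (t + 1))) ≤
      (1 - β₁) * (α * √(1 + Real.log T) / √((1 - β₂) * (1 - β₁ ^ 2 / β₂)) *
        √(∑ t ∈ range T, g (t + 1) ^ 2)) := by
  set c := (1 - β₁) / √((1 - β₂) * (1 - β₁ ^ 2 / β₂)) with hc_def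
  have hc : 0 ≤ c := div_nonneg (sub_nonneg.2 hβ₁1.le) (Real.sqrt_nonneg _)
  have hanti : Antitone fun t : ℕ => (√((t + 1 : ℕ) : ℝ))⁻¹ := fun s t hst => by
    dsimp only
    gcongr
  calc ∑ t ∈ range T, α / √((t + 1 : ℕ) : ℝ) * (ema β₁ g (t + 1) ^ 2 / √(vhat (t + 1)))
      ≤ ∑ t ∈ range T, α / √((t + 1 : ℕ) : ℝ) * (c * ema β₁ (fun s => |g s|) (t + 1)) := by
        gcongr with t
        exact ema_sq_div_sqrt_le hβ₁0 hβ₁1 hβ₂0 hβ₂1 hγ (hv (t + 1))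
    _ = α * c * ∑ t ∈ range T, (√((t + 1 : ℕ) : ℝ))⁻¹ * ema β₁ (fun s => |g s|) (t + 1) := by
        rw [mul_sum]
        exact sum_congr rfl fun t _ => by ring
    _ ≤ α * c * (√(1 + Real.log T) * √(∑ t ∈ range T, g (t + 1) ^ 2)) :=
        mul_le_mul_of_nonneg_left
          ((sum_mul_ema_le hβ₁0 hβ₁1 (fun _ => abs_nonneg _) hanti (fun _ => by positivity) T).trans
            (sum_inv_sqrt_mul_abs_le g T))
          (mul_nonneg hα hc)
    _ = _ := by rw [hc_def]; ring

end WeightedSums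

section AMSGrad

open Finset

variable {d : ℕ} {X : Set (E d)}

theorem abs_sub_le_supDiam (hX : IsCompact X) {x y : E d} (hx : x ∈ X) (hy : y ∈ X) (i : Fin d) :
    |x i - y i| ≤ supDiam X := by
  have hbdd : Bornology.IsBounded ((fun x : E d => (WithLp.ofLp x : Fin d → ℝ)) '' X) :=
    (hX.image (by fun_prop)).isBounded
  exact (dist_le_pi_dist (WithLp.ofLp x) (WithLp.ofLp y) i).trans
    (Metric.dist_le_diam_of_mem hbdd (Set.mem_image_of_mem _ hx) (Set.mem_image_of_mem _ hy))

theorem sub_sq_le_supDiam_sq (hX : IsCompact X) {x y : E d} (hx : x ∈ X) (hy : y ∈ X)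
    (i : Fin d) : (x i - y i) ^ 2 ≤ supDiam X ^ 2 :=
  sq_le_sq.2 ((abs_sub_le_supDiam hX hx hy i).trans (le_abs_self _))

theorem weightedSqNorm_nonneg {v : E d} (hv : ∀ i, 0 ≤ v i) (x : E d) : 0 ≤ weightedSqNorm v x :=
  sum_nonneg fun i _ => mul_nonneg (hv i) (sq_nonneg _)

theorem weightedSqNorm_sub_le (hX : IsCompact X) {v x y : E d} (hv : ∀ i, 0 ≤ v i) (hx : x ∈ X)
    (hy : y ∈ X) : weightedSqNorm v (x - y) ≤ supDiam X ^ 2 * ∑ i, v i := by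
  rw [mul_sum]
  refine sum_le_sum fun i _ => ?_
  rw [mul_comm]
  exact mul_le_mul_of_nonneg_right (sub_sq_le_supDiam_sq hX hx hy i) (hv i)

namespace State

/-- The diagonal `v̂^{1/2}` of the adaptive metric in which AMSGrad projects. -/
noncomputable def scale (S : State d) : E d :=
  WithLp.toLp 2 fun i => √(S.vhat i)

/-- The squared norm of the momentum `m` in the dual of the adaptive metric. -/
noncomputable def momentumSq (S : State d) : ℝ :=
  ∑ i, S.m i ^ 2 / √(S.vhat i)

/-- The point `x - a v̂^{-1/2} m` reached from `x` by a momentum step of size `a`, before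
projection. -/
noncomputable def descend (S : State d) (a : ℝ) (x : E d) : E d :=
  WithLp.toLp 2 fun i => x i - a * (S.m i / √(S.vhat i))

theorem momentumSq_nonneg (S : State d) : 0 ≤ S.momentumSq :=
  sum_nonneg fun _ _ => by positivity

theorem sum_scale_mul_sub_descend_mul {S : State d} (hS : ∀ i, 0 < S.vhat i) (a : ℝ)
    (x z : E d) :
    ∑ i, S.scale i * (x i - S.descend a x i) * z i = a * ∑ i, S.m i * z i := by
  rw [mul_sum]
  refine sum_congr rfl fun i _ => ?_
  have := Real.sqrt_pos.2 (hS i)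
  simp only [scale, descend]
  field_simp
  ring

theorem weightedSqNorm_scale_sub_descend {S : State d} (hS : ∀ i, 0 < S.vhat i) (a : ℝ)
    (x : E d) : weightedSqNorm S.scale (x - S.descend a x) = a * (a * S.momentumSq) := by
  simp only [weightedSqNorm, momentumSq, mul_sum]
  refine sum_congr rfl fun i _ => ?_
  have := Real.sqrt_pos.2 (hS i)
  simp only [scale, descend, PiLp.sub_apply]
  field_simp
  ring

end State

/-- `S` is a run of AMSGrad on the feasible set `X` with gradient inputs `g 1, g 2, …`: as in
`ZOAdaMM.run`, `S t` is the memory after `t` steps, so that step `t + 1` starts from the iterate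
`(S t).x`. -/
structure IsAMSGradRun (p : Params) (X : Set (E d)) (g : ℕ → E d) (S : ℕ → State d) : Prop where
  x_zero_mem : (S 0).x ∈ X
  m_zero : (S 0).m = 0
  v_zero : (S 0).v = 0
  vhat_zero : ∀ i, (S 0).vhat i = p.ε
  step : ∀ t, S (t + 1) = amsgradStep p X (t + 1) (g (t + 1)) (S t)

namespace IsAMSGradRun

variable {p : Params} {g : ℕ → E d} {S : ℕ → State d} {w : E d}

theorem m_apply (h : IsAMSGradRun p X g S) (t : ℕ) (i : Fin d) :
    (S t).m i = ema p.β₁ (fun s => g s i) t := by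
  induction t with
  | zero => simp [h.m_zero, ema]
  | succ t ih => simp [h.step, amsgradStep, ema, ih]

theorem v_apply (h : IsAMSGradRun p X g S) (t : ℕ) (i : Fin d) :
    (S t).v i = ema p.β₂ (fun s => g s i ^ 2) t := by
  induction t with
  | zero => simp [h.v_zero, ema]
  | succ t ih => simp [h.step, amsgradStep, ema, ih]

theorem vhat_succ (h : IsAMSGradRun p X g S) (t : ℕ) (i : Fin d) :
    (S (t + 1)).vhat i = max ((S t).vhat i) ((S (t + 1)).v i) := by
  rw [h.step]; rfl

theorem x_succ (h : IsAMSGradRun p X g S) (t : ℕ) :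
    (S (t + 1)).x = weightedProj X (S (t + 1)).scale
      ((S (t + 1)).descend (p.α / √((t + 1 : ℕ) : ℝ)) (S t).x) := by
  rw [h.step]; rfl

theorem x_mem (h : IsAMSGradRun p X g S) (hX : IsCompact X) : ∀ t, (S t).x ∈ X
  | 0 => h.x_zero_mem
  | t + 1 => h.x_succ t ▸ weightedProj_mem hX ⟨_, h.x_zero_mem⟩ _ _

theorem monotone_vhat (h : IsAMSGradRun p X g S) (i : Fin d) : Monotone fun t => (S t).vhat i :=
  monotone_nat_of_le_succ fun t => h.vhat_succ t i ▸ le_max_left _ _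

theorem le_vhat (h : IsAMSGradRun p X g S) (t : ℕ) (i : Fin d) : p.ε ≤ (S t).vhat i :=
  h.vhat_zero i ▸ h.monotone_vhat i t.zero_le

theorem vhat_pos (h : IsAMSGradRun p X g S) (hε : 0 < p.ε) (t : ℕ) (i : Fin d) :
    0 < (S t).vhat i :=
  hε.trans_le (h.le_vhat t i)

theorem ema_sq_le_vhat (h : IsAMSGradRun p X g S) (hε : 0 ≤ p.ε) (i : Fin d) (t : ℕ) :
    ema p.β₂ (fun s => g s i ^ 2) t ≤ (S t).vhat i := by
  rw [← h.v_apply]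
  cases t with
  | zero => simpa [h.v_zero, h.vhat_zero] using hε
  | succ t => exact h.vhat_succ t i ▸ le_max_right _ _

theorem sqrt_vhat_succ_le (h : IsAMSGradRun p X g S) (hβ₂0 : 0 ≤ p.β₂) (hβ₂1 : p.β₂ ≤ 1)
    (hε : 0 ≤ p.ε) (t : ℕ) (i : Fin d) :
    √((S (t + 1)).vhat i) ≤ √((S t).vhat i) + |g (t + 1) i| := by
  have hvhat : 0 ≤ (S t).vhat i := hε.trans (h.le_vhat t i)
  have hema := h.ema_sq_le_vhat hε i t
  have hv : (S (t + 1)).v i ≤ (S t).vhat i + g (t + 1) i ^ 2 := by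
    rw [h.v_apply, ema]
    nlinarith [sq_nonneg (g (t + 1) i)]
  calc √((S (t + 1)).vhat i) ≤ √((S t).vhat i + g (t + 1) i ^ 2) := by
        rw [h.vhat_succ]
        exact Real.sqrt_le_sqrt (max_le (le_add_of_nonneg_right (sq_nonneg _)) hv)
    _ ≤ √((S t).vhat i) + |g (t + 1) i| := by
        refine Real.sqrt_le_iff.2 ⟨by positivity, ?_⟩
        rw [add_sq, Real.sq_sqrt hvhat, sq_abs]
        linarith [mul_nonneg (Real.sqrt_nonneg ((S t).vhat i)) (abs_nonneg (g (t + 1) i))]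

theorem sum_sqrt_mul_weightedSqNorm_sub_le (h : IsAMSGradRun p X g S) (hX : IsCompact X)
    (hα : 0 < p.α) (hw : w ∈ X) (T : ℕ) :
    ∑ t ∈ range T, √((t + 1 : ℕ) : ℝ) / (2 * p.α) *
        (weightedSqNorm (S (t + 1)).scale ((S t).x - w) -
          weightedSqNorm (S (t + 1)).scale ((S (t + 1)).x - w)) ≤
      √(T : ℝ) / (2 * p.α) * (supDiam X ^ 2 * ∑ i, √((S T).vhat i)) := by
  have hcoord : ∀ i, ∑ t ∈ range T, √((t + 1 : ℕ) : ℝ) / (2 * p.α) * √((S (t + 1)).vhat i) *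
      (((S t).x i - w i) ^ 2 - ((S (t + 1)).x i - w i) ^ 2) ≤
        √(T : ℝ) / (2 * p.α) * √((S T).vhat i) * supDiam X ^ 2 := fun i => by
    have hmono : Monotone fun t : ℕ => √(t : ℝ) / (2 * p.α) * √((S t).vhat i) :=
      fun s t hst => by
        have := h.monotone_vhat i hst
        dsimp only at this ⊢
        gcongr
    refine (sum_mul_sub_succ_le hmono (by simp)
      (fun t => sub_sq_le_supDiam_sq hX (h.x_mem hX t) hw i) T).trans ?_
    gcongr
    exact sub_le_self _ (sq_nonneg _)
  calc _ = ∑ i, ∑ t ∈ range T, √((t + 1 : ℕ) : ℝ) / (2 * p.α) * √((S (t + 1)).vhat i) *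
      (((S t).x i - w i) ^ 2 - ((S (t + 1)).x i - w i) ^ 2) := by
        rw [sum_comm]
        refine sum_congr rfl fun t _ => ?_
        simp only [weightedSqNorm, State.scale, PiLp.sub_apply, ← sum_sub_distrib, mul_sum]
        exact sum_congr rfl fun i _ => by ring
    _ ≤ ∑ i, √(T : ℝ) / (2 * p.α) * √((S T).vhat i) * supDiam X ^ 2 :=
        sum_le_sum fun i _ => hcoord i
    _ = _ := by
        rw [mul_sum, mul_sum]
        exact sum_congr rfl fun i _ => by ring

section Potential

variable (h : IsAMSGradRun p X g S) (hX : IsCompact X) (hXc : Convex ℝ X) (hα : 0 < p.α)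
  (hε : 0 < p.ε)

include h hX hXc hα hε

theorem sum_m_mul_sub_le (hw : w ∈ X) (t : ℕ) :
    ∑ i, (S (t + 1)).m i * ((S t).x i - w i) ≤
      √((t + 1 : ℕ) : ℝ) / (2 * p.α) * (weightedSqNorm (S (t + 1)).scale ((S t).x - w) -
          weightedSqNorm (S (t + 1)).scale ((S (t + 1)).x - w)) +
        p.α / √((t + 1 : ℕ) : ℝ) * (S (t + 1)).momentumSq / 2 := by
  set a := p.α / √((t + 1 : ℕ) : ℝ) with ha_def
  have ha : 0 < a := by positivity
  have hproj := sum_mul_sub_le_of_weightedProj hX hXc (S t).x ((S (t + 1)).descend a (S t).x) hw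
    (s := (S (t + 1)).scale) fun i => Real.sqrt_nonneg _
  rw [State.weightedSqNorm_scale_sub_descend (h.vhat_pos hε _), ← h.x_succ] at hproj
  have hinner := State.sum_scale_mul_sub_descend_mul (h.vhat_pos hε (t + 1)) a (S t).x ((S t).x - w)
  simp only [PiLp.sub_apply] at hinner
  refine le_of_mul_le_mul_left ((hinner.symm.trans_le hproj).trans_eq ?_) ha
  rw [ha_def]
  field_simp

theorem sum_m_mul_sub_x_succ_le (t : ℕ) :
    ∑ i, (S (t + 1)).m i * ((S t).x i - (S (t + 1)).x i) ≤
      p.α / √((t + 1 : ℕ) : ℝ) * (S (t + 1)).momentumSq := by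
  have ha : 0 < p.α / √((t + 1 : ℕ) : ℝ) := by positivity
  refine le_of_mul_le_mul_left ?_ ha
  rw [← State.weightedSqNorm_scale_sub_descend (h.vhat_pos hε _) _ (S t).x]
  have hinner := State.sum_scale_mul_sub_descend_mul (h.vhat_pos hε (t + 1))
    (p.α / √((t + 1 : ℕ) : ℝ)) (S t).x ((S t).x - (S (t + 1)).x)
  simp only [PiLp.sub_apply] at hinner
  rw [← hinner, h.x_succ t]
  exact sum_mul_sub_weightedProj_le hX hXc (fun i => Real.sqrt_nonneg _) (h.x_mem hX t) _

theorem sum_m_mul_x_sub_le (hw : w ∈ X) (T : ℕ) :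
    ∑ i, (S T).m i * ((S T).x i - w i) ≤
      √(T : ℝ) / (2 * p.α) * (supDiam X ^ 2 * ∑ i, √((S T).vhat i)) := by
  cases T with
  | zero => simp [h.m_zero]
  | succ t => ?_
  have ha : 0 < p.α / √((t + 1 : ℕ) : ℝ) := by positivity
  have hproj := sum_mul_weightedProj_sub_le hX hXc (S (t + 1)).scale (S t).x
    ((S (t + 1)).descend (p.α / √((t + 1 : ℕ) : ℝ)) (S t).x) hw
  have hinner := State.sum_scale_mul_sub_descend_mul (h.vhat_pos hε (t + 1))
    (p.α / √((t + 1 : ℕ) : ℝ)) (S t).x ((S (t + 1)).x - w)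
  simp only [PiLp.sub_apply] at hinner
  have hscale : ∀ i, 0 ≤ (S (t + 1)).scale i := fun i => Real.sqrt_nonneg _
  rw [← h.x_succ, hinner] at hproj
  refine le_of_mul_le_mul_left (hproj.trans ?_) ha
  calc _ ≤ weightedSqNorm (S (t + 1)).scale ((S t).x - w) / 2 := by
        linarith [weightedSqNorm_nonneg hscale ((S (t + 1)).x - w),
          weightedSqNorm_nonneg hscale ((S (t + 1)).x - (S t).x)]
    _ ≤ supDiam X ^ 2 * ∑ i, (S (t + 1)).scale i / 2 := by
        rw [← sum_div, ← mul_div_assoc]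
        gcongr
        exact weightedSqNorm_sub_le hX hscale (h.x_mem hX t) hw
    _ = _ := by
        simp only [State.scale, ← sum_div]
        field_simp

theorem one_sub_mul_sum_inner_le (hβ₁0 : 0 ≤ p.β₁) (hβ₁1 : p.β₁ ≤ 1) (hw : w ∈ X) (T : ℕ) :
    (1 - p.β₁) * ∑ t ∈ range T, ∑ i, g (t + 1) i * ((S t).x i - w i) ≤
      √(T : ℝ) / (2 * p.α) * (supDiam X ^ 2 * ∑ i, √((S T).vhat i)) +
        ∑ t ∈ range T, p.α / √((t + 1 : ℕ) : ℝ) * (S (t + 1)).momentumSq := by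
  have hparts : (1 - p.β₁) * ∑ t ∈ range T, ∑ i, g (t + 1) i * ((S t).x i - w i) =
      (1 - p.β₁) * ∑ t ∈ range T, ∑ i, (S (t + 1)).m i * ((S t).x i - w i) +
        p.β₁ * (∑ i, (S T).m i * ((S T).x i - w i) +
          ∑ t ∈ range T, ∑ i, (S (t + 1)).m i * ((S t).x i - (S (t + 1)).x i)) := by
    have hcoord := fun i => one_sub_mul_sum_mul_eq_sum_ema_mul (β := p.β₁)
      (g := fun t => g t i) (fun t => (S t).x i - w i) T
    simp only [← h.m_apply, sub_sub_sub_cancel_right] at hcoord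
    simp only [sum_comm (s := range T), mul_sum (s := univ), ← sum_add_distrib, hcoord]
  have hmain : ∑ t ∈ range T, ∑ i, (S (t + 1)).m i * ((S t).x i - w i) ≤
      √(T : ℝ) / (2 * p.α) * (supDiam X ^ 2 * ∑ i, √((S T).vhat i)) +
        (∑ t ∈ range T, p.α / √((t + 1 : ℕ) : ℝ) * (S (t + 1)).momentumSq) / 2 := by
    refine (sum_le_sum fun t _ => h.sum_m_mul_sub_le hX hXc hα hε hw t).trans ?_
    rw [sum_add_distrib, sum_div]
    gcongr
    exact h.sum_sqrt_mul_weightedSqNorm_sub_le hX hα hw T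
  have hdrift : ∑ t ∈ range T, ∑ i, (S (t + 1)).m i * ((S t).x i - (S (t + 1)).x i) ≤
      ∑ t ∈ range T, p.α / √((t + 1 : ℕ) : ℝ) * (S (t + 1)).momentumSq :=
    sum_le_sum fun t _ => h.sum_m_mul_sub_x_succ_le hX hXc hα hε t
  have hlast := h.sum_m_mul_x_sub_le hX hXc hα hε hw T
  have hpot : 0 ≤ ∑ t ∈ range T, p.α / √((t + 1 : ℕ) : ℝ) * (S (t + 1)).momentumSq :=
    sum_nonneg fun t _ => mul_nonneg (by positivity) (S (t + 1)).momentumSq_nonneg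
  rw [hparts]
  linarith [mul_le_mul_of_nonneg_left hmain (sub_nonneg.2 hβ₁1),
    mul_le_mul_of_nonneg_left (add_le_add hlast hdrift) hβ₁0,
    mul_nonneg (sub_nonneg.2 hβ₁1) hpot]

end Potential

theorem sum_momentumSq_le (h : IsAMSGradRun p X g S) (hα : 0 ≤ p.α) (hβ₁0 : 0 ≤ p.β₁)
    (hβ₁1 : p.β₁ < 1) (hβ₂0 : 0 < p.β₂) (hβ₂1 : p.β₂ < 1) (hγ : p.β₁ ^ 2 / p.β₂ < 1)
    (hε : 0 ≤ p.ε) (T : ℕ) :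
    ∑ t ∈ range T, p.α / √((t + 1 : ℕ) : ℝ) * (S (t + 1)).momentumSq ≤
      (1 - p.β₁) * (p.α * √(1 + Real.log T) / √((1 - p.β₂) * (1 - p.β₁ ^ 2 / p.β₂)) *
        ∑ i, √(∑ t ∈ range T, g (t + 1) i ^ 2)) := by
  simp only [State.momentumSq, mul_sum]
  rw [sum_comm]
  refine sum_le_sum fun i _ => ?_
  simp only [h.m_apply]
  exact sum_ema_sq_div_sqrt_le hα hβ₁0 hβ₁1 hβ₂0 hβ₂1 hγ (h.ema_sq_le_vhat hε i) T

theorem sum_inner_le (h : IsAMSGradRun p X g S) (hX : IsCompact X) (hXc : Convex ℝ X)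
    (hα : 0 < p.α) (hβ₁0 : 0 ≤ p.β₁) (hβ₁1 : p.β₁ < 1) (hβ₂0 : 0 < p.β₂) (hβ₂1 : p.β₂ < 1)
    (hγ : p.β₁ ^ 2 / p.β₂ < 1) (hε : 0 < p.ε) (hw : w ∈ X) (T : ℕ) :
    ∑ t ∈ range T, inner ℝ (g (t + 1)) ((S t).x - w) ≤
      supDiam X ^ 2 * √(T : ℝ) / (2 * p.α * (1 - p.β₁)) * ∑ i, √((S T).vhat i) +
        p.α * √(1 + Real.log T) / √((1 - p.β₂) * (1 - p.β₁ ^ 2 / p.β₂)) *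
          ∑ i, √(∑ t ∈ range T, g (t + 1) i ^ 2) := by
  have hβ : 0 < 1 - p.β₁ := sub_pos.2 hβ₁1
  have hinner : ∀ t, inner ℝ (g (t + 1)) ((S t).x - w) =
      ∑ i, g (t + 1) i * ((S t).x i - w i) := fun t => by
    simp [PiLp.inner_apply, mul_comm]
  simp only [hinner]
  refine le_of_mul_le_mul_left ?_ hβ
  calc _ ≤ _ := h.one_sub_mul_sum_inner_le hX hXc hα hε hβ₁0 hβ₁1.le hw T
    _ ≤ _ := add_le_add_right (h.sum_momentumSq_le hα.le hβ₁0 hβ₁1 hβ₂0 hβ₂1 hγ hε.le T) _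
    _ = _ := by field_simp

end IsAMSGradRun

variable {Ξ : Type*}

theorem isAMSGradRun_run (p : Params) (f : E d → Ξ → ℝ) {x₁ : E d} (hx₁ : x₁ ∈ X) (ξ : ℕ → Ξ)
    (u : ℕ → E d) : IsAMSGradRun p X (gradEst p X f x₁ ξ u) (run p X f x₁ ξ u) where
  x_zero_mem := hx₁
  m_zero := rfl
  v_zero := rfl
  vhat_zero _ := rfl
  step _ := rfl

theorem iter_mem {f : E d → Ξ → ℝ} (hX : IsCompact X) {x₁ : E d} (hx₁ : x₁ ∈ X) (ξ : ℕ → Ξ)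
    (u : ℕ → E d) (t : ℕ) : iter p X f x₁ ξ u t ∈ X :=
  (isAMSGradRun_run p f hx₁ ξ u).x_mem hX (t - 1)

theorem norm_iter_sub_le_diam {f : E d → Ξ → ℝ} (hX : IsCompact X) {x₁ : E d} (hx₁ : x₁ ∈ X)
    (ξ : ℕ → Ξ) (u : ℕ → E d) (t : ℕ) (hw : w ∈ X) :
    ‖iter p X f x₁ ξ u t - w‖ ≤ Metric.diam X := by
  rw [← dist_eq_norm_sub]
  exact Metric.dist_le_diam_of_mem hX.isBounded (iter_mem hX hx₁ ξ u t) hw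

theorem sum_inner_gradEst_le {f : E d → Ξ → ℝ} (hX : IsCompact X) (hXc : Convex ℝ X)
    (hα : 0 < p.α) (hβ₁0 : 0 ≤ p.β₁) (hβ₁1 : p.β₁ < 1) (hβ₂0 : 0 < p.β₂) (hβ₂1 : p.β₂ < 1)
    (hγ : p.β₁ ^ 2 / p.β₂ < 1) (hε : 0 < p.ε) {x₁ : E d} (hx₁ : x₁ ∈ X) (ξ : ℕ → Ξ)
    (u : ℕ → E d) (hw : w ∈ X) (T : ℕ) :
    ∑ t ∈ Icc 1 T, inner ℝ (gradEst p X f x₁ ξ u t) (iter p X f x₁ ξ u t - w) ≤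
      supDiam X ^ 2 * √(T : ℝ) / (2 * p.α * (1 - p.β₁)) * ∑ i, √(vHat p X f x₁ ξ u T i) +
        p.α * √(1 + Real.log T) / √((1 - p.β₂) * (1 - p.β₁ ^ 2 / p.β₂)) *
          ∑ i, √(∑ t ∈ Icc 1 T, gradEst p X f x₁ ξ u t i ^ 2) := by
  have hshift : ∀ h : ℕ → ℝ, ∑ t ∈ Icc 1 T, h t = ∑ t ∈ range T, h (t + 1) := fun h => by
    rw [range_eq_Ico, sum_Ico_add' h 0 T 1, zero_add, Ico_add_one_right_eq_Icc]
  simp only [hshift]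
  exact (isAMSGradRun_run p f hx₁ ξ u).sum_inner_le hX hXc hα hβ₁0 hβ₁1 hβ₂0 hβ₂1 hγ hε hw T

end AMSGrad

section Measurability

variable {d : ℕ} {Ω : Type*} [MeasurableSpace Ω]

/-- The σ-algebra on the memory of the method generated by its four vectors. -/
instance measurableSpaceState : MeasurableSpace (State d) :=
  MeasurableSpace.comap (fun S => (S.x, S.m, S.v, S.vhat)) inferInstance

theorem measurable_state_iff {S : Ω → State d} :
    Measurable S ↔ Measurable (fun ω => (S ω).x) ∧ Measurable (fun ω => (S ω).m) ∧
      Measurable (fun ω => (S ω).v) ∧ Measurable fun ω => (S ω).vhat := by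
  rw [measurable_comap_iff]
  simp only [measurable_fun_prod, Function.comp_def]

theorem measurable_toLp {a : Fin d → Ω → ℝ} (ha : ∀ i, Measurable (a i)) :
    Measurable fun ω => (WithLp.toLp 2 fun i => a i ω : E d) :=
  (WithLp.measurable_toLp 2 _).comp (measurable_pi_lambda _ ha)

theorem measurable_apply {x : Ω → E d} (hx : Measurable x) (i : Fin d) :
    Measurable fun ω => x ω i :=
  (EuclideanSpace.proj (𝕜 := ℝ) i).measurable.comp hx

theorem measurable_amsgradStep {X : Set (E d)} (hX : IsCompact X) (hXc : Convex ℝ X)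
    (hne : X.Nonempty) (p : Params) (t : ℕ) {g : Ω → E d} {S : Ω → State d} (hg : Measurable g)
    (hS : Measurable S) (hpos : ∀ ω i, 0 < (S ω).vhat i) :
    Measurable fun ω => amsgradStep p X t (g ω) (S ω) := by
  obtain ⟨hx, hm, hv, hvhat⟩ := measurable_state_iff.1 hS
  have hm' : Measurable fun ω => (amsgradStep p X t (g ω) (S ω)).m :=
    (hm.const_smul p.β₁).add (hg.const_smul (1 - p.β₁))
  have hv' : Measurable fun ω => (amsgradStep p X t (g ω) (S ω)).v :=
    measurable_toLp fun i => ((measurable_apply hv i).const_mul _).add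
      (((measurable_apply hg i).pow_const 2).const_mul _)
  have hvhat' : Measurable fun ω => (amsgradStep p X t (g ω) (S ω)).vhat :=
    measurable_toLp fun i => (measurable_apply hvhat i).max (measurable_apply hv' i)
  have hscale : Measurable fun ω => (amsgradStep p X t (g ω) (S ω)).scale :=
    measurable_toLp fun i => (measurable_apply hvhat' i).sqrt
  have hdescend : Measurable fun ω =>
      (amsgradStep p X t (g ω) (S ω)).descend (p.α / √(t : ℝ)) (S ω).x :=
    measurable_toLp fun i => (measurable_apply hx i).sub
      (((measurable_apply hm' i).div (measurable_apply hvhat' i).sqrt).const_mul _)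
  refine measurable_state_iff.2 ⟨?_, hm', hv', hvhat'⟩
  exact measurable_weightedProj hX hXc hne hscale hdescend fun ω i =>
    Real.sqrt_pos.2 ((hpos ω i).trans_le (le_max_left _ _))

variable {Ξ : Type*} [MeasurableSpace Ξ] {f : E d → Ξ → ℝ}

theorem measurable_zoGrad (hf : Measurable (Function.uncurry f)) (μ : ℝ) {x v : Ω → E d}
    {s : Ω → Ξ} (hx : Measurable x) (hs : Measurable s) (hv : Measurable v) :
    Measurable fun ω => zoGrad f μ (x ω) (s ω) (v ω) := by
  have hshift : Measurable fun ω => f (x ω + μ • v ω) (s ω) :=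
    hf.comp ((hx.add (hv.const_smul μ)).prodMk hs)
  have hbase : Measurable fun ω => f (x ω) (s ω) := hf.comp (hx.prodMk hs)
  exact ((hshift.sub hbase).const_mul _).smul hv

theorem measurable_smoothed (hf : Measurable (Function.uncurry f)) (μ : ℝ) :
    Measurable fun q : E d × Ξ => smoothed f μ q.2 q.1 := by
  have hshift : Measurable fun r : (E d × Ξ) × E d => f (r.1.1 + μ • r.2) r.1.2 :=
    hf.comp ((measurable_fst.fst.add (measurable_snd.const_smul μ)).prodMk measurable_fst.snd)
  exact hshift.stronglyMeasurable.integral_prod_right.measurable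

variable {X : Set (E d)} {p : Params} {x₁ : E d} {ξ : ℕ → Ω → Ξ} {u : ℕ → Ω → E d}

theorem measurable_run (hX : IsCompact X) (hXc : Convex ℝ X) (hε : 0 < p.ε)
    (hf : Measurable (Function.uncurry f)) (hx₁ : x₁ ∈ X) (n : ℕ)
    (hsample : ∀ t ∈ Set.Icc 1 n, Measurable fun ω => (ξ t ω, u t ω)) :
    Measurable fun ω => run p X f x₁ (ξ · ω) (u · ω) n := by
  induction n with
  | zero => exact measurable_const
  | succ n ih =>
    have hrun := ih fun t ht => hsample t ⟨ht.1, ht.2.trans n.le_succ⟩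
    have hfresh := hsample (n + 1) ⟨Nat.le_add_left 1 n, le_rfl⟩
    exact measurable_amsgradStep hX hXc ⟨x₁, hx₁⟩ p (n + 1)
      (measurable_zoGrad hf p.μ (measurable_state_iff.1 hrun).1 hfresh.fst hfresh.snd) hrun
      fun ω => (isAMSGradRun_run p f hx₁ _ _).vhat_pos hε n

theorem indepFun_iter (hX : IsCompact X) (hXc : Convex ℝ X) (hε : 0 < p.ε)
    (hf : Measurable (Function.uncurry f)) (hx₁ : x₁ ∈ X) {Pr : Measure Ω}
    (hmeas : ∀ t, Measurable fun ω => (ξ t ω, u t ω))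
    (hindep : iIndepFun (fun t ω => (ξ t ω, u t ω)) Pr) {t : ℕ} (ht : 1 ≤ t) :
    IndepFun (fun ω => iter p X f x₁ (ξ · ω) (u · ω) t) (fun ω => (ξ t ω, u t ω)) Pr := by
  let 𝓜 : ℕ → MeasurableSpace Ω := fun t =>
    MeasurableSpace.comap (fun ω => (ξ t ω, u t ω)) inferInstance
  have hdisj : Disjoint (Set.Icc 1 (t - 1)) {t} := by
    rw [Set.disjoint_singleton_right, Set.mem_Icc]; omega
  have hpast_fresh := indep_iSup_of_disjoint (m := 𝓜) (fun t => (hmeas t).comap_le) hindep hdisj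
  have hfresh : 𝓜 t ≤ ⨆ j ∈ ({t} : Set ℕ), 𝓜 j :=
    le_iSup₂_of_le t (Set.mem_singleton t) le_rfl
  have hpast : Measurable[⨆ j ∈ Set.Icc 1 (t - 1), 𝓜 j] fun ω =>
      iter p X f x₁ (ξ · ω) (u · ω) t := by
    have hsample : ∀ j ∈ Set.Icc 1 (t - 1),
        Measurable[⨆ j ∈ Set.Icc 1 (t - 1), 𝓜 j] fun ω => (ξ j ω, u j ω) := fun j hj =>
      (comap_measurable _).mono (le_iSup₂_of_le (f := fun j _ => 𝓜 j) j hj le_rfl) le_rfl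
    let _ : MeasurableSpace Ω := ⨆ j ∈ Set.Icc 1 (t - 1), 𝓜 j
    exact (measurable_state_iff.1 (measurable_run hX hXc hε hf hx₁ (t - 1) hsample)).1
  exact indep_of_indep_of_le_left (indep_of_indep_of_le_right hpast_fresh hfresh) hpast.comap_le

end Measurability

section Freezing

variable {Ω α β : Type*} [MeasurableSpace Ω] [MeasurableSpace α] [MeasurableSpace β]
  {Pr : Measure Ω} [IsProbabilityMeasure Pr] {x : Ω → α} {y : Ω → β}

theorem lintegral_comp_of_indepFun {h : α × β → ℝ≥0∞} (hh : Measurable h) (hx : Measurable x)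
    (hy : Measurable y) (hxy : IndepFun x y Pr) :
    ∫⁻ ω, h (x ω, y ω) ∂Pr = ∫⁻ ω, ∫⁻ b, h (x ω, b) ∂Pr.map y ∂Pr := by
  rw [← lintegral_map hh (hx.prodMk hy),
    hxy.map_prod_eq_prod_map_map hx.aemeasurable hy.aemeasurable, lintegral_prod _ hh.aemeasurable,
    lintegral_map hh.lintegral_prod_right' hx]

theorem integrable_comp_of_indepFun {G : Type*} [NormedAddCommGroup G] {h : α × β → G}
    (hh : StronglyMeasurable h) (hx : Measurable x) (hy : Measurable y) (hxy : IndepFun x y Pr)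
    {K : ℝ≥0∞} (hK : K ≠ ∞) (hle : ∀ ω, ∫⁻ b, ‖h (x ω, b)‖ₑ ∂Pr.map y ≤ K) :
    Integrable (fun ω => h (x ω, y ω)) Pr := by
  refine ⟨(hh.comp_measurable (hx.prodMk hy)).aestronglyMeasurable, ?_⟩
  calc ∫⁻ ω, ‖h (x ω, y ω)‖ₑ ∂Pr = ∫⁻ ω, ∫⁻ b, ‖h (x ω, b)‖ₑ ∂Pr.map y ∂Pr :=
        lintegral_comp_of_indepFun hh.enorm hx hy hxy
    _ ≤ ∫⁻ _, K ∂Pr := lintegral_mono hle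
    _ < ∞ := by simpa using hK.lt_top

theorem integral_comp_le_integral_comp_of_indepFun {k h : α × β → ℝ} (hk : Measurable k)
    (hh : Measurable h) (hx : Measurable x) (hy : Measurable y) (hxy : IndepFun x y Pr)
    (hkint : Integrable (fun ω => k (x ω, y ω)) Pr)
    (hhint : Integrable (fun ω => h (x ω, y ω)) Pr)
    (hle : ∀ ω, ∫ b, k (x ω, b) ∂Pr.map y ≤ ∫ b, h (x ω, b) ∂Pr.map y) :
    ∫ ω, k (x ω, y ω) ∂Pr ≤ ∫ ω, h (x ω, y ω) ∂Pr := by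
  have hprod := hxy.map_prod_eq_prod_map_map hx.aemeasurable hy.aemeasurable
  have hpair := (hx.prodMk hy).aemeasurable (μ := Pr)
  have hintegrable : ∀ {j : α × β → ℝ}, Measurable j → Integrable (fun ω => j (x ω, y ω)) Pr →
      Integrable j ((Pr.map x).prod (Pr.map y)) := fun hj hjint => by
    rwa [← hprod, integrable_map_measure hj.aestronglyMeasurable hpair]
  have hfreeze : ∀ {j : α × β → ℝ}, Measurable j → Integrable (fun ω => j (x ω, y ω)) Pr →
      ∫ ω, j (x ω, y ω) ∂Pr = ∫ ω, ∫ b, j (x ω, b) ∂Pr.map y ∂Pr := fun hj hjint => by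
    rw [← integral_map hpair hj.aestronglyMeasurable, hprod,
      integral_prod _ (hintegrable hj hjint), integral_map hx.aemeasurable
        hj.stronglyMeasurable.integral_prod_right'.aestronglyMeasurable]
  rw [hfreeze hk hkint, hfreeze hh hhint]
  exact integral_mono ((hintegrable hk hkint).integral_prod_left.comp_measurable hx)
    ((hintegrable hh hhint).integral_prod_left.comp_measurable hx) hle

end Freezing

section Moments

open Metric

variable {d : ℕ} {Ξ : Type*} [MeasurableSpace Ξ] {P : Measure Ξ} {S : Set (E d)}
  {μ : ℝ} {f : E d → Ξ → ℝ} {C : ℝ≥0} {x z : E d}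
  (hμ : 0 ≤ μ) (hf : Measurable (Function.uncurry f))
  (hC : ∀ y ∈ S, ∫⁻ s, ‖f y s‖ₑ ∂P ≤ C) (hx : closedBall x μ ⊆ S)

include hf in
theorem measurable_comp_add_smul (μ : ℝ) (x : E d) :
    Measurable fun q : Ξ × E d => f (x + μ • q.2) q.1 :=
  hf.comp (((measurable_snd.const_smul μ).const_add x).prodMk measurable_fst)

include hf hC in
theorem integrable_of_lintegral_enorm_le {y : E d} (hy : y ∈ S) : Integrable (f y) P :=
  ⟨hf.of_uncurry_left.aestronglyMeasurable, (hC y hy).trans_lt ENNReal.coe_lt_top⟩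

variable [IsProbabilityMeasure P]

include hμ hf hC hx

theorem lintegral_enorm_comp_add_smul_le {ρ : Measure (E d)} [IsProbabilityMeasure ρ]
    (hρ : ∀ᵐ w ∂ρ, ‖w‖ ≤ 1) :
    ∫⁻ q, ‖f (x + μ • q.2) q.1‖ₑ ∂P.prod ρ ≤ C := by
  rw [lintegral_prod_symm _ (measurable_comp_add_smul hf μ x).enorm.aemeasurable]
  calc _ ≤ ∫⁻ _, (C : ℝ≥0∞) ∂ρ := by
        refine lintegral_mono_ae ?_
        filter_upwards [hρ] with w hw
        exact hC _ (hx (add_smul_mem_closedBall hμ hw x))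
    _ = C := by simp

theorem lintegral_enorm_smoothed_le : ∫⁻ s, ‖smoothed f μ s x‖ₑ ∂P ≤ C := by
  calc ∫⁻ s, ‖smoothed f μ s x‖ₑ ∂P ≤ ∫⁻ s, ∫⁻ w, ‖f (x + μ • w) s‖ₑ ∂unifBall d ∂P :=
        lintegral_mono fun s => enorm_integral_le_lintegral_enorm _
    _ = ∫⁻ q, ‖f (x + μ • q.2) q.1‖ₑ ∂P.prod (unifBall d) :=
        (lintegral_prod _ (measurable_comp_add_smul hf μ x).enorm.aemeasurable).symm
    _ ≤ C := lintegral_enorm_comp_add_smul_le hμ hf hC hx ae_norm_le_one_unifBall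

theorem integrable_smoothed : Integrable (fun s => smoothed f μ s x) P :=
  ⟨((measurable_smoothed hf μ).comp measurable_prodMk_left).aestronglyMeasurable,
    (lintegral_enorm_smoothed_le hμ hf hC hx).trans_lt ENNReal.coe_lt_top⟩

theorem integral_smoothed :
    ∫ s, smoothed f μ s x ∂P = ∫ w, ∫ s, f (x + μ • w) s ∂P ∂unifBall d :=
  integral_integral_swap ⟨(measurable_comp_add_smul hf μ x).aestronglyMeasurable,
    (lintegral_enorm_comp_add_smul_le hμ hf hC hx ae_norm_le_one_unifBall).trans_lt
      ENNReal.coe_lt_top⟩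

variable [NeZero d]

theorem lintegral_enorm_zoGrad_le :
    ∫⁻ q, ‖zoGrad f μ x q.1 q.2‖ₑ ∂P.prod (unifSphere d) ≤ ‖(d : ℝ) / μ‖ₑ * (C + C) := by
  have hnorm : ∀ᵐ q ∂P.prod (unifSphere d), ‖q.2‖ₑ = 1 := by
    refine Measure.quasiMeasurePreserving_snd.ae (p := fun u : E d => ‖u‖ₑ = 1) ?_
    filter_upwards [ae_norm_eq_one_unifSphere] with u hu
    rw [← ofReal_norm, hu, ENNReal.ofReal_one]
  have hshift : ∫⁻ q, ‖f (x + μ • q.2) q.1‖ₑ ∂P.prod (unifSphere d) ≤ C :=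
    lintegral_enorm_comp_add_smul_le hμ hf hC hx
      (ae_norm_eq_one_unifSphere.mono fun _ hu => hu.le)
  have hbase : ∫⁻ q, ‖f x q.1‖ₑ ∂P.prod (unifSphere d) ≤ C := by
    have hfst := lintegral_prod (μ := P) (ν := unifSphere d) (fun q => ‖f x q.1‖ₑ)
      (hf.comp (measurable_const.prodMk measurable_fst)).enorm.aemeasurable
    simpa [hfst] using hC x (hx (mem_closedBall_self hμ))
  calc ∫⁻ q, ‖zoGrad f μ x q.1 q.2‖ₑ ∂P.prod (unifSphere d)
      ≤ ∫⁻ q, ‖(d : ℝ) / μ‖ₑ * (‖f (x + μ • q.2) q.1‖ₑ + ‖f x q.1‖ₑ)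
          ∂P.prod (unifSphere d) := by
        refine lintegral_mono_ae ?_
        filter_upwards [hnorm] with q hq
        rw [zoGrad, enorm_smul, enorm_mul, hq, mul_one]
        gcongr
        exact enorm_sub_le
    _ ≤ ‖(d : ℝ) / μ‖ₑ * (C + C) := by
        rw [lintegral_const_mul' _ _ enorm_ne_top,
          lintegral_add_left (measurable_comp_add_smul hf μ x).enorm]
        gcongr

theorem integral_inner_zoGrad (v : E d) :
    ∫ q, inner ℝ (zoGrad f μ x q.1 q.2) v ∂P.prod (unifSphere d) =
      ∫ u, (d : ℝ) / μ * (∫ s, f (x + μ • u) s ∂P - ∫ s, f x s ∂P) * inner ℝ u v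
        ∂unifSphere d := by
  have hint : Integrable (fun q : Ξ × E d => zoGrad f μ x q.1 q.2) (P.prod (unifSphere d)) :=
    ⟨(measurable_zoGrad hf μ measurable_const measurable_fst measurable_snd).aestronglyMeasurable,
      (lintegral_enorm_zoGrad_le hμ hf hC hx).trans_lt (ENNReal.mul_lt_top enorm_lt_top (by simp))⟩
  rw [integral_prod_symm _ (hint.inner_const v)]
  refine integral_congr_ae ?_
  filter_upwards [ae_norm_eq_one_unifSphere] with u hu
  have hshift := integrable_of_lintegral_enorm_le hf hC (hx (add_smul_mem_closedBall hμ hu.le x))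
  have hbase := integrable_of_lintegral_enorm_le hf hC (hx (mem_closedBall_self hμ))
  simp only [zoGrad, real_inner_smul_left]
  rw [integral_mul_const, integral_const_mul, integral_sub hshift hbase]

omit hμ in
theorem integral_smoothed_sub_le_integral_inner_zoGrad (hμ : 0 < μ) (hz : closedBall z μ ⊆ S)
    (hconv : ConvexOn ℝ S fun y => ∫ s, f y s ∂P) {K : ℝ≥0}
    (hlip : LipschitzOnWith K (fun y => ∫ s, f y s ∂P) S) :
    ∫ s, (smoothed f μ s x - smoothed f μ s z) ∂P ≤
      ∫ q, inner ℝ (zoGrad f μ x q.1 q.2) (x - z) ∂P.prod (unifSphere d) := by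
  rw [integral_sub (integrable_smoothed hμ.le hf hC hx) (integrable_smoothed hμ.le hf hC hz),
    integral_smoothed hμ.le hf hC hx, integral_smoothed hμ.le hf hC hz,
    integral_inner_zoGrad hμ.le hf hC hx]
  exact integral_unifBall_sub_le hμ hconv hlip hx hz

end Moments

section Sampling

open Metric Finset

variable {d : ℕ} {Ξ Ω : Type*} [MeasurableSpace Ξ] [MeasurableSpace Ω] {P : Measure Ξ}
  {Pr : Measure Ω}

theorem unifSphere_zero : unifSphere 0 = 0 := by
  have htoSphere : (volume : Measure (E 0)).toSphere = 0 :=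
    (Measure.toSphere_eq_zero_iff _).2 inferInstance
  simp [unifSphere, htoSphere, ProbabilityTheory.cond]

/-- A sample `s` with law `P` and a uniform direction `v`, independent of each other and, jointly,
of the random point `x`: the randomness of a single step started at `x`. -/
structure IsFreshSample (P : Measure Ξ) (Pr : Measure Ω) (x : Ω → E d) (s : Ω → Ξ)
    (v : Ω → E d) : Prop where
  measurable_point : Measurable x
  measurable_sample : Measurable fun ω => (s ω, v ω)
  indepFun : IndepFun x (fun ω => (s ω, v ω)) Pr
  map_eq : Pr.map (fun ω => (s ω, v ω)) = P.prod (unifSphere d)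

namespace IsFreshSample

variable {x : Ω → E d} {s : Ω → Ξ} {v : Ω → E d} [IsProbabilityMeasure Pr]

theorem neZero (h : IsFreshSample P Pr x s v) : NeZero d := by
  refine ⟨?_⟩
  rintro rfl
  have hprob := Measure.isProbabilityMeasure_map (μ := Pr) h.measurable_sample.aemeasurable
  rw [h.map_eq, unifSphere_zero, Measure.prod_zero] at hprob
  exact IsProbabilityMeasure.ne_zero (0 : Measure (Ξ × E 0)) rfl

theorem const (h : IsFreshSample P Pr x s v) (z : E d) : IsFreshSample P Pr (fun _ => z) s v where
  measurable_point := measurable_const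
  measurable_sample := h.measurable_sample
  indepFun := indepFun_const_left z _
  map_eq := h.map_eq

variable [IsProbabilityMeasure P] {S : Set (E d)} {μ : ℝ} {f : E d → Ξ → ℝ} {C : ℝ≥0}
  (h : IsFreshSample P Pr x s v) (hμ : 0 < μ) (hf : Measurable (Function.uncurry f))
  (hC : ∀ y ∈ S, ∫⁻ s, ‖f y s‖ₑ ∂P ≤ C) (hx : ∀ ω, closedBall (x ω) μ ⊆ S)

include h hμ hf hC hx

theorem integrable_smoothed : Integrable (fun ω => smoothed f μ (s ω) (x ω)) Pr := by
  have := h.neZero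
  have hmeas : Measurable fun q : E d × (Ξ × E d) => smoothed f μ q.2.1 q.1 :=
    (measurable_smoothed hf μ).comp (measurable_fst.prodMk measurable_snd.fst)
  refine integrable_comp_of_indepFun hmeas.stronglyMeasurable h.measurable_point
    h.measurable_sample h.indepFun (ENNReal.coe_ne_top (r := C)) fun ω => ?_
  have hsample : Measurable fun b : Ξ × E d => smoothed f μ b.1 (x ω) :=
    hmeas.comp measurable_prodMk_left
  rw [h.map_eq, lintegral_prod _ hsample.enorm.aemeasurable]
  simpa using lintegral_enorm_smoothed_le hμ.le hf hC (hx ω)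

theorem integrable_zoGrad : Integrable (fun ω => zoGrad f μ (x ω) (s ω) (v ω)) Pr := by
  have := h.neZero
  have hmeas : Measurable fun q : E d × (Ξ × E d) => zoGrad f μ q.1 q.2.1 q.2.2 :=
    measurable_zoGrad hf μ measurable_fst measurable_snd.fst measurable_snd.snd
  have hbound : ‖(d : ℝ) / μ‖ₑ * (C + C) ≠ ∞ := ENNReal.mul_ne_top enorm_ne_top (by simp)
  have hmoment : ∀ ω, ∫⁻ b, ‖zoGrad f μ (x ω) b.1 b.2‖ₑ ∂Pr.map (fun ω => (s ω, v ω)) ≤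
      ‖(d : ℝ) / μ‖ₑ * (C + C) := fun ω =>
    h.map_eq ▸ lintegral_enorm_zoGrad_le hμ.le hf hC (hx ω)
  simpa only using integrable_comp_of_indepFun hmeas.stronglyMeasurable h.measurable_point
    h.measurable_sample h.indepFun hbound hmoment

theorem integrable_inner_zoGrad {z : E d} {R : ℝ} (hR : ∀ ω, ‖x ω - z‖ ≤ R) :
    Integrable (fun ω => inner ℝ (zoGrad f μ (x ω) (s ω) (v ω)) (x ω - z)) Pr := by
  have hgrad := h.integrable_zoGrad hμ hf hC hx
  refine (hgrad.norm.mul_const R).mono' (hgrad.aestronglyMeasurable.inner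
    (h.measurable_point.sub_const z).aestronglyMeasurable) (.of_forall fun ω => ?_)
  exact (norm_inner_le_norm _ _).trans (mul_le_mul_of_nonneg_left (hR ω) (norm_nonneg _))

theorem integral_smoothed_sub_le {z : E d} (hz : closedBall z μ ⊆ S) {R : ℝ}
    (hR : ∀ ω, ‖x ω - z‖ ≤ R) (hconv : ConvexOn ℝ S fun y => ∫ s, f y s ∂P) {K : ℝ≥0}
    (hlip : LipschitzOnWith K (fun y => ∫ s, f y s ∂P) S) :
    ∫ ω, (smoothed f μ (s ω) (x ω) - smoothed f μ (s ω) z) ∂Pr ≤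
      ∫ ω, inner ℝ (zoGrad f μ (x ω) (s ω) (v ω)) (x ω - z) ∂Pr := by
  have := h.neZero
  have hgap : Measurable fun q : E d × (Ξ × E d) => smoothed f μ q.2.1 q.1 - smoothed f μ q.2.1 z :=
    ((measurable_smoothed hf μ).comp (measurable_fst.prodMk measurable_snd.fst)).sub
      ((measurable_smoothed hf μ).comp (measurable_const.prodMk measurable_snd.fst))
  have hinner : Measurable fun q : E d × (Ξ × E d) =>
      inner ℝ (zoGrad f μ q.1 q.2.1 q.2.2) (q.1 - z) :=
    (measurable_zoGrad hf μ measurable_fst measurable_snd.fst measurable_snd.snd).inner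
      (measurable_fst.sub_const z)
  refine integral_comp_le_integral_comp_of_indepFun hgap hinner h.measurable_point
    h.measurable_sample h.indepFun ((h.integrable_smoothed hμ hf hC hx).sub
      ((h.const z).integrable_smoothed hμ hf hC fun _ => hz))
    (h.integrable_inner_zoGrad hμ hf hC hx hR) fun ω => ?_
  rw [h.map_eq]
  have hmarginal := integral_fun_fst (μ := P) (ν := unifSphere d)
    fun s => smoothed f μ s (x ω) - smoothed f μ s z
  simp only [probReal_univ, one_smul] at hmarginal
  exact hmarginal.trans_le
    (integral_smoothed_sub_le_integral_inner_zoGrad hf hC (hx ω) hμ hz hconv hlip)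

end IsFreshSample

/-- The pairs `(ξ t, u t)` are i.i.d. with law `P ⊗ Unif(sphere)`: the randomness driving the
method. -/
structure IsSampling (P : Measure Ξ) (Pr : Measure Ω) (ξ : ℕ → Ω → Ξ) (u : ℕ → Ω → E d) :
    Prop where
  measurable : ∀ t, Measurable fun ω => (ξ t ω, u t ω)
  iIndepFun : iIndepFun (fun t ω => (ξ t ω, u t ω)) Pr
  map_eq : ∀ t, Pr.map (fun ω => (ξ t ω, u t ω)) = P.prod (unifSphere d)

namespace IsSampling

variable {ξ : ℕ → Ω → Ξ} {u : ℕ → Ω → E d} {p : Params} {X : Set (E d)} {f : E d → Ξ → ℝ}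
  {x₁ : E d} (h : IsSampling P Pr ξ u) (hX : IsCompact X) (hXc : Convex ℝ X) (hε : 0 < p.ε)
  (hf : Measurable (Function.uncurry f)) (hx₁ : x₁ ∈ X)

include h hX hXc hε hf hx₁

theorem measurable_run (t : ℕ) : Measurable fun ω => run p X f x₁ (ξ · ω) (u · ω) t :=
  ZOAdaMM.measurable_run hX hXc hε hf hx₁ t fun s _ => h.measurable s

theorem isFreshSample_iter {t : ℕ} (ht : 1 ≤ t) :
    IsFreshSample P Pr (fun ω => iter p X f x₁ (ξ · ω) (u · ω) t) (ξ t) (u t) where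
  measurable_point := (measurable_state_iff.1 (h.measurable_run hX hXc hε hf hx₁ (t - 1))).1
  measurable_sample := h.measurable t
  indepFun := indepFun_iter hX hXc hε hf hx₁ h.measurable h.iIndepFun ht
  map_eq := h.map_eq t

theorem measurable_sqrt_vHat (t : ℕ) (i : Fin d) :
    Measurable fun ω => √(vHat p X f x₁ (ξ · ω) (u · ω) t i) :=
  (measurable_apply (measurable_state_iff.1 (h.measurable_run hX hXc hε hf hx₁ t)).2.2.2 i).sqrt

theorem measurable_gradEst_apply (t : ℕ) (i : Fin d) :
    Measurable fun ω => gradEst p X f x₁ (ξ · ω) (u · ω) t i :=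
  measurable_apply (measurable_zoGrad hf p.μ
    (measurable_state_iff.1 (h.measurable_run hX hXc hε hf hx₁ (t - 1))).1
    (h.measurable t).fst (h.measurable t).snd) i

variable [IsProbabilityMeasure Pr] [IsProbabilityMeasure P] {S : Set (E d)} {C : ℝ≥0}
  (hμ : 0 < p.μ) (hC : ∀ y ∈ S, ∫⁻ s, ‖f y s‖ₑ ∂P ≤ C) (hXS : ∀ x ∈ X, closedBall x p.μ ⊆ S)

include hμ hC hXS

theorem integrable_gradEst {t : ℕ} (ht : 1 ≤ t) :
    Integrable (fun ω => gradEst p X f x₁ (ξ · ω) (u · ω) t) Pr :=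
  (h.isFreshSample_iter hX hXc hε hf hx₁ ht).integrable_zoGrad hμ hf hC fun _ =>
    hXS _ (iter_mem hX hx₁ _ _ t)

theorem integrable_sqrt_vHat (hβ₂0 : 0 ≤ p.β₂) (hβ₂1 : p.β₂ ≤ 1) (t : ℕ) (i : Fin d) :
    Integrable (fun ω => √(vHat p X f x₁ (ξ · ω) (u · ω) t i)) Pr := by
  induction t with
  | zero => exact integrable_const √p.ε
  | succ t ih =>
    have hgrad : Integrable (fun ω => gradEst p X f x₁ (ξ · ω) (u · ω) (t + 1) i) Pr :=
      (EuclideanSpace.proj (𝕜 := ℝ) i).integrable_comp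
        (h.integrable_gradEst hX hXc hε hf hx₁ hμ hC hXS (Nat.le_add_left 1 t))
    refine (ih.add hgrad.abs).mono'
      (h.measurable_sqrt_vHat hX hXc hε hf hx₁ (t + 1) i).aestronglyMeasurable
      (.of_forall fun ω => ?_)
    rw [Real.norm_of_nonneg (Real.sqrt_nonneg _)]
    exact (isAMSGradRun_run p f hx₁ _ _).sqrt_vhat_succ_le hβ₂0 hβ₂1 hε.le t i

variable {z : E d} (hz : z ∈ X)

include hz

theorem integrable_smoothed_sub {t : ℕ} (ht : 1 ≤ t) :
    Integrable (fun ω => smoothed f p.μ (ξ t ω) (iter p X f x₁ (ξ · ω) (u · ω) t) -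
      smoothed f p.μ (ξ t ω) z) Pr :=
  have hfresh := h.isFreshSample_iter hX hXc hε hf hx₁ ht
  (hfresh.integrable_smoothed hμ hf hC fun _ =>
    hXS _ (iter_mem hX hx₁ _ _ t)).sub
  ((hfresh.const z).integrable_smoothed hμ hf hC fun _ => hXS z hz)

theorem integrable_smoothedRegret (T : ℕ) :
    Integrable (fun ω => smoothedRegret p X f x₁ (ξ · ω) (u · ω) T z) Pr :=
  integrable_finsetSum _ fun _ ht =>
    h.integrable_smoothed_sub hX hXc hε hf hx₁ hμ hC hXS hz (mem_Icc.1 ht).1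

theorem integrable_inner_gradEst {t : ℕ} (ht : 1 ≤ t) :
    Integrable (fun ω => inner ℝ (gradEst p X f x₁ (ξ · ω) (u · ω) t)
      (iter p X f x₁ (ξ · ω) (u · ω) t - z)) Pr :=
  (h.isFreshSample_iter hX hXc hε hf hx₁ ht).integrable_inner_zoGrad hμ hf hC
    (fun _ => hXS _ (iter_mem hX hx₁ _ _ t)) fun _ => norm_iter_sub_le_diam hX hx₁ _ _ t hz

theorem integral_smoothedRegret_le (hconv : ConvexOn ℝ S fun y => ∫ s, f y s ∂P) {K : ℝ≥0}
    (hlip : LipschitzOnWith K (fun y => ∫ s, f y s ∂P) S) (T : ℕ) :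
    ∫ ω, smoothedRegret p X f x₁ (ξ · ω) (u · ω) T z ∂Pr ≤
      ∫ ω, ∑ t ∈ Icc 1 T, inner ℝ (gradEst p X f x₁ (ξ · ω) (u · ω) t)
        (iter p X f x₁ (ξ · ω) (u · ω) t - z) ∂Pr := by
  simp only [smoothedRegret]
  rw [integral_finsetSum _ fun t ht => h.integrable_smoothed_sub hX hXc hε hf hx₁ hμ hC hXS hz
      (mem_Icc.1 ht).1,
    integral_finsetSum _ fun t ht => h.integrable_inner_gradEst hX hXc hε hf hx₁ hμ hC hXS hz
      (mem_Icc.1 ht).1]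
  refine sum_le_sum fun t ht => ?_
  exact (h.isFreshSample_iter hX hXc hε hf hx₁ (mem_Icc.1 ht).1).integral_smoothed_sub_le hμ hf hC
    (fun _ => hXS _ (iter_mem hX hx₁ _ _ t)) (hXS z hz)
    (fun _ => norm_iter_sub_le_diam hX hx₁ _ _ t hz) hconv hlip

end IsSampling

end Sampling

section Expectation

open Finset

variable {Ω : Type*} [MeasurableSpace Ω] {Pr : Measure Ω}

theorem ofReal_integral_le_lintegral_ofReal {h : Ω → ℝ} (hh : Integrable h Pr) :
    ENNReal.ofReal (∫ ω, h ω ∂Pr) ≤ ∫⁻ ω, ENNReal.ofReal (h ω) ∂Pr := by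
  rw [integral_eq_lintegral_pos_part_sub_lintegral_neg_part hh]
  exact (ENNReal.ofReal_le_ofReal (sub_le_self _ ENNReal.toReal_nonneg)).trans
    ENNReal.ofReal_toReal_le

theorem ofReal_integral_le_mul_sum_lintegral_add {ι : Type*} [Fintype ι] {h : Ω → ℝ}
    {a b : ι → Ω → ℝ} (hh : Integrable h Pr) (ha : ∀ i, Measurable (a i))
    (hb : ∀ i, Measurable (b i)) (ha0 : ∀ i ω, 0 ≤ a i ω) (hb0 : ∀ i ω, 0 ≤ b i ω) {c₁ c₂ : ℝ}
    (hc₁ : 0 ≤ c₁) (hc₂ : 0 ≤ c₂) (hle : ∀ ω, h ω ≤ c₁ * ∑ i, a i ω + c₂ * ∑ i, b i ω) :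
    ENNReal.ofReal (∫ ω, h ω ∂Pr) ≤
      ENNReal.ofReal c₁ * ∑ i, ∫⁻ ω, ENNReal.ofReal (a i ω) ∂Pr +
        ENNReal.ofReal c₂ * ∑ i, ∫⁻ ω, ENNReal.ofReal (b i ω) ∂Pr := by
  have hmeas : ∀ {e : ι → Ω → ℝ}, (∀ i, Measurable (e i)) →
      Measurable fun ω => ∑ i, ENNReal.ofReal (e i ω) := fun he =>
    Finset.measurable_fun_sum _ fun i _ => (he i).ennreal_ofReal
  calc ENNReal.ofReal (∫ ω, h ω ∂Pr) ≤ ∫⁻ ω, ENNReal.ofReal (h ω) ∂Pr :=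
        ofReal_integral_le_lintegral_ofReal hh
    _ ≤ ∫⁻ ω, (ENNReal.ofReal c₁ * ∑ i, ENNReal.ofReal (a i ω) +
          ENNReal.ofReal c₂ * ∑ i, ENNReal.ofReal (b i ω)) ∂Pr := by
        refine lintegral_mono fun ω => (ENNReal.ofReal_le_ofReal (hle ω)).trans_eq ?_
        rw [ENNReal.ofReal_add (mul_nonneg hc₁ (sum_nonneg fun i _ => ha0 i ω))
            (mul_nonneg hc₂ (sum_nonneg fun i _ => hb0 i ω)), ENNReal.ofReal_mul hc₁,
          ENNReal.ofReal_mul hc₂, ENNReal.ofReal_sum_of_nonneg fun i _ => ha0 i ω,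
          ENNReal.ofReal_sum_of_nonneg fun i _ => hb0 i ω]
    _ = _ := by
        rw [lintegral_add_left ((hmeas ha).const_mul _), lintegral_const_mul _ (hmeas ha),
          lintegral_const_mul _ (hmeas hb), lintegral_finsetSum _ fun i _ => (ha i).ennreal_ofReal,
          lintegral_finsetSum _ fun i _ => (hb i).ennreal_ofReal]

variable [IsProbabilityMeasure Pr]

theorem lintegral_rpow_half_le {h : Ω → ℝ≥0∞} (hh : Measurable h) :
    ∫⁻ ω, h ω ^ (1 / 2 : ℝ) ∂Pr ≤ (∫⁻ ω, h ω ∂Pr) ^ (1 / 2 : ℝ) := by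
  have hcauchy := ENNReal.lintegral_mul_le_Lp_mul_Lq Pr Real.HolderConjugate.two_two
    (f := fun ω => h ω ^ (1 / 2 : ℝ)) (g := fun _ => 1) (hh.pow_const _).aemeasurable
    measurable_const.aemeasurable
  have hsq : ∀ ω, (h ω ^ (1 / 2 : ℝ)) ^ (2 : ℝ) = h ω := fun ω => by
    rw [← ENNReal.rpow_mul]; norm_num
  simpa only [Pi.mul_apply, mul_one, hsq, ENNReal.one_rpow, lintegral_const, measure_univ]
    using hcauchy

theorem lintegral_sqrt_sum_sq_le {ι : Type*} (s : Finset ι) {g : ι → Ω → ℝ}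
    (hg : ∀ t, Measurable (g t)) :
    ∫⁻ ω, ENNReal.ofReal √(∑ t ∈ s, g t ω ^ 2) ∂Pr ≤
      (∑ t ∈ s, ∫⁻ ω, ENNReal.ofReal (g t ω ^ 2) ∂Pr) ^ (1 / 2 : ℝ) := by
  have hmeas : ∀ t, Measurable fun ω => ENNReal.ofReal (g t ω ^ 2) := fun t =>
    ((hg t).pow_const 2).ennreal_ofReal
  have hsqrt : ∀ ω, ENNReal.ofReal √(∑ t ∈ s, g t ω ^ 2) =
      (∑ t ∈ s, ENNReal.ofReal (g t ω ^ 2)) ^ (1 / 2 : ℝ) := fun ω => by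
    rw [Real.sqrt_eq_rpow, ← ENNReal.ofReal_rpow_of_nonneg (sum_nonneg fun _ _ => sq_nonneg _)
      (by norm_num), ENNReal.ofReal_sum_of_nonneg fun _ _ => sq_nonneg _]
  simp only [hsqrt, ← lintegral_finsetSum s fun t _ => hmeas t]
  exact lintegral_rpow_half_le (Finset.measurable_fun_sum _ fun t _ => hmeas t)

end Expectation

end ZOAdaMM

theorem proposition1_general
    {d : ℕ} {Ξ : Type*} [MeasurableSpace Ξ] (P : Measure Ξ) [IsProbabilityMeasure P]
    (p : Params) (hα : 0 < p.α) (hβ₁0 : 0 ≤ p.β₁) (hβ₁ : p.β₁ < 1) (hβ₂0 : 0 < p.β₂)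
    (hβ₂ : p.β₂ < 1) (hγ : p.β₁ ^ 2 / p.β₂ < 1) (hε : 0 < p.ε) (hμ : 0 < p.μ)
    (X : Set (E d)) (hXcompact : IsCompact X) (hXconvex : Convex ℝ X)
    (f : E d → Ξ → ℝ) (hfmeas : Measurable (Function.uncurry f))
    (hfint : ∃ C : ℝ≥0, ∀ x ∈ Metric.cthickening p.μ X, ∫⁻ s, ‖f x s‖ₑ ∂P ≤ C)
    (hconv : ConvexOn ℝ (Metric.cthickening p.μ X) fun x => ∫ s, f x s ∂P)
    (Lc : ℝ≥0) (hlip : LipschitzOnWith Lc (fun x => ∫ s, f x s ∂P) (Metric.cthickening p.μ X))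
    (z : E d) (hz : z ∈ X) (x₁ : E d) (hx₁ : x₁ ∈ X)
    {Ω : Type*} [MeasurableSpace Ω] (Pr : Measure Ω) [IsProbabilityMeasure Pr]
    (ξ : ℕ → Ω → Ξ) (u : ℕ → Ω → E d) (hsampling : IsSampling P Pr ξ u) (T : ℕ) :
    Integrable (fun ω => smoothedRegret p X f x₁ (ξ · ω) (u · ω) T z) Pr ∧
    (∀ i, Integrable (fun ω => √(vHat p X f x₁ (ξ · ω) (u · ω) T i)) Pr) ∧
    ENNReal.ofReal (∫ ω, smoothedRegret p X f x₁ (ξ · ω) (u · ω) T z ∂Pr) ≤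
      ENNReal.ofReal (supDiam X ^ 2 * √(T : ℝ) / (2 * p.α * (1 - p.β₁))) *
          ∑ i, ∫⁻ ω, ENNReal.ofReal √(vHat p X f x₁ (ξ · ω) (u · ω) T i) ∂Pr +
        ENNReal.ofReal (p.α * √(1 + Real.log T) / √((1 - p.β₂) * (1 - p.β₁ ^ 2 / p.β₂))) *
          ∑ i, (∑ t ∈ Finset.Icc 1 T,
            ∫⁻ ω, ENNReal.ofReal (gradEst p X f x₁ (ξ · ω) (u · ω) t i ^ 2) ∂Pr) ^ (1 / 2 : ℝ) := by
  obtain ⟨C, hC⟩ := hfint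
  have hXS : ∀ x ∈ X, Metric.closedBall x p.μ ⊆ Metric.cthickening p.μ X := fun x hx =>
    Metric.closedBall_subset_cthickening hx p.μ
  have hvhat := hsampling.measurable_sqrt_vHat hXcompact hXconvex hε hfmeas hx₁ T
  have hgrad := hsampling.measurable_gradEst_apply hXcompact hXconvex hε hfmeas hx₁
  have hsum := integrable_finsetSum (Finset.Icc 1 T) fun t ht =>
    hsampling.integrable_inner_gradEst hXcompact hXconvex hε hfmeas hx₁ hμ hC hXS hz
      (Finset.mem_Icc.1 ht).1
  refine ⟨hsampling.integrable_smoothedRegret hXcompact hXconvex hε hfmeas hx₁ hμ hC hXS hz T,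
    hsampling.integrable_sqrt_vHat hXcompact hXconvex hε hfmeas hx₁ hμ hC hXS hβ₂0.le hβ₂.le T,
    (ENNReal.ofReal_le_ofReal (hsampling.integral_smoothedRegret_le hXcompact hXconvex hε hfmeas
      hx₁ hμ hC hXS hz hconv hlip T)).trans ?_⟩
  refine (ofReal_integral_le_mul_sum_lintegral_add hsum hvhat
    (fun i => (Finset.measurable_fun_sum _ fun t _ => (hgrad t i).pow_const 2).sqrt)
    (fun _ _ => Real.sqrt_nonneg _) (fun _ _ => Real.sqrt_nonneg _)
    (by have := sub_pos.2 hβ₁; positivity) (by positivity) fun ω =>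
      sum_inner_gradEst_le hXcompact hXconvex hα hβ₁0 hβ₁ hβ₂0 hβ₂ hγ hε hx₁ _ _ hz T).trans ?_
  gcongr with i
  exact lintegral_sqrt_sum_sq_le _ fun t => hgrad t i

theorem proposition1
    {d : ℕ} {Ξ : Type*} [MeasurableSpace Ξ] (P : Measure Ξ) [IsProbabilityMeasure P]
    (p : Params) (hα : 0 < p.α) (hβ₁0 : 0 ≤ p.β₁) (hβ₁ : p.β₁ < 1) (hβ₂0 : 0 < p.β₂)
    (hβ₂ : p.β₂ < 1) (γ : ℝ) (hγ : γ = p.β₁ ^ 2 / p.β₂) (hγ1 : γ < 1)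
    (hε : 0 < p.ε) (hμ : 0 < p.μ)
    -- the feasible set and its sup-norm diameter
    (X : Set (E d)) (hXcompact : IsCompact X) (hXconvex : Convex ℝ X)
    (D : ℝ) (hD : D = supDiam X)
    -- the sample losses `f(·; s)`, with first moments bounded on the `μ`-neighbourhood of `X`
    (f : E d → Ξ → ℝ) (hfmeas : Measurable (Function.uncurry f))
    (hfint : ∃ C : ℝ≥0, ∀ x ∈ Metric.cthickening p.μ X, ∫⁻ s, ‖f x s‖ₑ ∂P ≤ C)
    -- the objective `F(x) = 𝔼_s f(x; s)`
    (F : E d → ℝ) (hF : ∀ x, F x = ∫ s, f x s ∂P)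
    (hconv : ConvexOn ℝ (Metric.cthickening p.μ X) F)
    (L : ℝ≥0) (hsmooth : LSmoothOn L F (Metric.thickening p.μ X))
    (Lc : ℝ≥0) (hlip : LipschitzOnWith Lc F (Metric.cthickening p.μ X))
    (xstar : E d) (hxstar : xstar ∈ X) (hmin : IsMinOn F X xstar)
    (x₁ : E d) (hx₁ : x₁ ∈ X)
    -- the random samples and directions: i.i.d. pairs with law `P ⊗ Unif(sphere)`
    {Ω : Type*} [MeasurableSpace Ω] (Pr : Measure Ω) [IsProbabilityMeasure Pr]
    (ξ : ℕ → Ω → Ξ) (u : ℕ → Ω → E d)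
    (hξ : ∀ t, Measurable (ξ t)) (hu : ∀ t, Measurable (u t))
    (hindep : iIndepFun (fun t ω => (ξ t ω, u t ω)) Pr)
    (hlaw : ∀ t, Pr.map (fun ω => (ξ t ω, u t ω)) = P.prod (unifSphere d))
    (T : ℕ) (hT : 1 ≤ T) :
    Integrable (fun ω => smoothedRegret p X f x₁ (ξ · ω) (u · ω) T xstar) Pr ∧
    (∀ i, Integrable (fun ω => √(vHat p X f x₁ (ξ · ω) (u · ω) T i)) Pr) ∧
    ENNReal.ofReal (∫ ω, smoothedRegret p X f x₁ (ξ · ω) (u · ω) T xstar ∂Pr) ≤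
      ENNReal.ofReal (D ^ 2 * √(T : ℝ) / (2 * p.α * (1 - p.β₁))) *
          ∑ i, ∫⁻ ω, ENNReal.ofReal √(vHat p X f x₁ (ξ · ω) (u · ω) T i) ∂Pr +
        ENNReal.ofReal (p.α * √(1 + Real.log T) / √((1 - p.β₂) * (1 - γ))) *
          ∑ i, (∑ t ∈ Finset.Icc 1 T,
            ∫⁻ ω, ENNReal.ofReal (gradEst p X f x₁ (ξ · ω) (u · ω) t i ^ 2) ∂Pr) ^ (1 / 2 : ℝ) := by
  obtain rfl : F = fun x => ∫ s, f x s ∂P := funext hF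
  subst hγ hD
  exact proposition1_general P p hα hβ₁0 hβ₁ hβ₂0 hβ₂ hγ1 hε hμ X hXcompact hXconvex f hfmeas hfint
    hconv Lc hlip xstar hxstar x₁ hx₁ Pr ξ u ⟨fun t => (hξ t).prodMk (hu t), hindep, hlaw⟩ T
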